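/- Let $\mu$ be the Lebesgue measure on $E=\mathbb R^d$, let $\mathcal H=L^2(\mu)$ (complex-valued functions), and for $f\in L^\infty(\mu)$ let $M_f\in\mathcal B(\mathcal H)$ be the operator of multiplication by $f$. All completely positive (CP) maps are understood to be normal (weak*-continuous) and identity preserving. Let $(P_t)_{t\ge0}$ be a family of operators on $L^\infty(\mu)$ such that (A1) $(P_t)$ is $\mu$-preserving: $\int P_tf\,d\mu=\int f\,d\mu$ for all $t\ge0$ and $f\in L^1(\mu)\cap L^\infty(\mu)$; (A2) $(P_t)$ is the transition semigroup, $P_tf(x)=\mathbb E_x[f(X_t)]$ for $\mu$-almost every $x$, of a Markov process $(X_t)_{t\ge0}$ on $\mathbb R^d$ with stationary and independent increments. That is, there are laws $(\mathbb P_x)_{x\in\mathbb R^d}$, depending measurably on $x$, such that under $\mathbb P_x$ one has $X_0=x$ almost surely, the increments of $X$ are independent, and the law of $X_{s+t}-X_s$ depends only on $t$ (not on $s$, and not on $x$). Let $F=\{w:\mathbb R\to\mathbb R^d : w_0=0\}$ with the $\sigma$-algebra generated by the coordinates, and let $\nu$ be the law on $F$ of the two-sided process equal to $X_s-X_0$ for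 $s\ge0$ and to $-(X'_{-s}-X'_0)$ for $s<0$, where $X'$ is an independent copy of $X$ and both are started at $0$. For $t\in\mathbb R$ put $\eta_t(w)=(w_{t+s}-w_t)_{s\in\mathbb R}$ on $F$ and $\theta_t(x,w)=(x+w_t,\eta_t(w))$ on $E\times F$. Then $(\eta_t)_{t\in\mathbb R}$ and $(\theta_t)_{t\in\mathbb R}$ are one-parameter groups of invertible maps preserving $\nu$ and $\mu\otimes\nu$ respectively, and $(\theta_t)$ is a dilation of $(P_t)$: for $t\ge0$ and $f\in L^\infty(\mu)$, $P_tf(x)=\int_F (f\otimes 1)(\theta_t(x,w))\,d\nu(w)$ for $\mu$-almost every $x$. Let $\mathcal K=L^2(\nu)$ and identify $\mathcal H\otimes\mathcal K$ with $L^2(\mu\otimes\nu)$. The formulas $U_th=h\circ\theta_t^{-1}$ and $\Theta_th=h\circ(\mathrm{id}_E\times\eta_t)$ define one-parameter groups of unitary operators on $\mathcal H\otimes\mathcal K$, and the unitary operators $V_t=\Theta_t^*U_t$, $t\ge0$, form a left cocycle: $$V_{s+t}=\Theta_s^*V_t\Theta_sV_s\qquad(s,t\ge0).$$ The partial traces $$\mathcal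 P_t(X)=\mathrm{Tr}_{|1\rangle\langle1|}\big[V_t^*(X\otimes I)V_t\big],\qquad X\in\mathcal B(\mathcal H),\ t\ge0,$$ over the pure state of $\mathcal K$ given by the constant function $1$ form a semigroup of CP maps on $\mathcal B(\mathcal H)$ (with $\mathcal P_0=\mathrm{id}$), and $$\mathcal P_t(M_f)=M_{P_tf}\qquad\text{for all }t\ge0,\ f\in L^\infty(\mu).$$ If moreover (B) for all $\psi\in L^2(\mu)$, $\mathbb E_\mu\big[|\psi(X_t)-\psi(X_0)|^2\big]\to0$ as $t\to0$, where $\mathbb E_\mu$ is the integral with respect to the measure $\mathbb P_\mu=\int\mathbb P_x\,d\mu(x)$, then $(\mathcal P_t)_{t\ge0}$ is weak*-continuous, i.e. $t\mapsto\mathcal P_t(X)$ is weak*-continuous on $[0,\infty)$ for every $X\in\mathcal B(\mathcal H)$; consequently it is a quantum Markov semigroup. -/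

import Mathlib

open MeasureTheory ProbabilityTheory Filter Topology
open scoped NNReal ENNReal InnerProductSpace CStarAlgebra

noncomputable section

namespace SubclassicalExtension

/-! ### Operators on Hilbert spaces -/

section Operators

/-- The weak* (or `σ`-weak) topology of `B(H)`, for `H` a Hilbert space: the coarsest topology for
which all functionals `X ↦ ∑ₙ ⟪φₙ, X ψₙ⟫`, with `∑ₙ ‖φₙ‖² < ∞` and `∑ₙ ‖ψₙ‖² < ∞`, are
continuous.  These are exactly the functionals `X ↦ Tr (X ρ)` with `ρ` of trace class. -/
def sigmaWeak (H : Type*) [NormedAddCommGroup H] [InnerProductSpace ℂ H] :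
    TopologicalSpace (H →L[ℂ] H) :=
  ⨅ (φ : lp (fun _ : ℕ => H) 2) (ψ : lp (fun _ : ℕ => H) 2),
    TopologicalSpace.induced (fun X : H →L[ℂ] H => ∑' n, ⟪φ n, X (ψ n)⟫_ℂ) inferInstance

variable {H : Type*} [NormedAddCommGroup H] [InnerProductSpace ℂ H] [CompleteSpace H]

/-- A semigroup, indexed by `[0, ∞)`, of normal and identity preserving completely positive maps
on `B(H)`. -/
structure IsCPSemigroup (T : ℝ≥0 → ((H →L[ℂ] H) →CP (H →L[ℂ] H))) : Prop where
  normal : ∀ t, Continuous[sigmaWeak H, sigmaWeak H] (T t)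
  map_one : ∀ t, T t 1 = 1
  zero : ∀ X, T 0 X = X
  add : ∀ s t X, T (s + t) X = T s (T t X)

/-- A quantum Markov semigroup: a weak*-continuous semigroup of normal and identity preserving
completely positive maps on `B(H)`. -/
structure IsQuantumMarkovSemigroup (T : ℝ≥0 → ((H →L[ℂ] H) →CP (H →L[ℂ] H))) : Prop
    extends IsCPSemigroup T where
  continuous : ∀ X, Continuous[inferInstance, sigmaWeak H] (fun t => T t X)

/-- A one-parameter group of unitary operators on `H`. -/
structure IsUnitaryGroup (U : ℝ → unitary (H →L[ℂ] H)) : Prop where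
  zero : U 0 = 1
  add : ∀ s t, U (s + t) = U s * U t

end Operators

/-! ### `L²` spaces, and the identification `L²(μ) ⊗ L²(ν) = L²(μ ⊗ ν)` -/

section LTwo

variable {α β : Type*} [MeasurableSpace α] [MeasurableSpace β]

/-- The Hilbert space `L²(μ)` of complex-valued functions. -/
abbrev L2 (μ : Measure α) : Type _ := Lp ℂ 2 μ

/-- The algebra `L^∞(μ)` of complex-valued functions. -/
abbrev LInf (μ : Measure α) : Type _ := Lp ℂ ∞ μ

/-- The multiplication operator `M_f : g ↦ f g` on `L²(μ)`, for `f ∈ L^∞(μ)`. -/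
def mulOp {μ : Measure α} (f : LInf μ) : L2 μ →L[ℂ] L2 μ :=
  (ContinuousLinearMap.mul ℂ ℂ).holderL μ ∞ 2 2 f

theorem mulOp_coeFn {μ : Measure α} (f : LInf μ) (g : L2 μ) :
    mulOp f g =ᵐ[μ] fun x => f x * g x :=
  (ContinuousLinearMap.mul ℂ ℂ).coeFn_holder f g

theorem norm_sq_eq_integral {μ : Measure α} (f : L2 μ) : ‖f‖ ^ 2 = ∫ x, ‖f x‖ ^ 2 ∂μ := by
  have h := congrArg RCLike.re (L2.inner_def (𝕜 := ℂ) f f)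
  rw [inner_self_eq_norm_sq] at h
  rw [h, ← integral_re (L2.integrable_inner f f)]
  simp only [inner_self_eq_norm_sq]

variable {μ : Measure α} {ν : Measure β}

theorem memLp_tensor (ψ : L2 μ) (φ : L2 ν) :
    MemLp (fun z : α × β => ψ z.1 * φ z.2) 2 (μ.prod ν) := by
  have hm : AEStronglyMeasurable (fun z : α × β => ψ z.1 * φ z.2) (μ.prod ν) :=
    ((Lp.aestronglyMeasurable ψ).comp_fst).mul ((Lp.aestronglyMeasurable φ).comp_snd)
  rw [memLp_two_iff_integrable_sq_norm hm]
  have h1 := (memLp_two_iff_integrable_sq_norm (Lp.aestronglyMeasurable ψ)).1 (Lp.memLp ψ)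
  have h2 := (memLp_two_iff_integrable_sq_norm (Lp.aestronglyMeasurable φ)).1 (Lp.memLp φ)
  simpa [mul_pow] using h1.mul_prod h2

/-- The elementary tensor `ψ ⊗ φ : (x, y) ↦ ψ(x) φ(y)`, as an element of `L²(μ ⊗ ν)`. -/
def tensor (ψ : L2 μ) (φ : L2 ν) : L2 (μ.prod ν) := (memLp_tensor ψ φ).toLp

theorem tensor_coeFn (ψ : L2 μ) (φ : L2 ν) :
    tensor ψ φ =ᵐ[μ.prod ν] fun z => ψ z.1 * φ z.2 :=
  (memLp_tensor ψ φ).coeFn_toLp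

variable [SFinite μ] [SFinite ν]

theorem norm_tensor (ψ : L2 μ) (φ : L2 ν) : ‖tensor ψ φ‖ = ‖ψ‖ * ‖φ‖ := by
  have h : ‖tensor ψ φ‖ ^ 2 = (‖ψ‖ * ‖φ‖) ^ 2 := by
    rw [mul_pow, norm_sq_eq_integral ψ, norm_sq_eq_integral φ, norm_sq_eq_integral (tensor ψ φ),
      ← integral_prod_mul]
    refine integral_congr_ae ?_
    filter_upwards [tensor_coeFn ψ φ] with z hz
    rw [hz, norm_mul, mul_pow]
  exact (pow_left_inj₀ (norm_nonneg _) (by positivity) two_ne_zero).1 h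

/-- The operator `ψ ↦ ψ ⊗ χ` from `L²(μ)` to `L²(μ ⊗ ν)`. -/
def tensorRight (χ : L2 ν) : L2 μ →L[ℂ] L2 (μ.prod ν) :=
  LinearMap.mkContinuous
    { toFun := fun ψ => tensor ψ χ
      map_add' := fun ψ₁ ψ₂ => by
        refine Lp.ext ?_
        have h := Measure.quasiMeasurePreserving_fst (μ := μ) (ν := ν) |>.ae (Lp.coeFn_add ψ₁ ψ₂)
        filter_upwards [tensor_coeFn (ψ₁ + ψ₂) χ, tensor_coeFn ψ₁ χ, tensor_coeFn ψ₂ χ,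
          Lp.coeFn_add (tensor ψ₁ χ) (tensor ψ₂ χ), h] with z h1 h2 h3 h4 h5
        simp only [h1, h4, Pi.add_apply, h2, h3, h5, add_mul]
      map_smul' := fun c ψ => by
        refine Lp.ext ?_
        have h := Measure.quasiMeasurePreserving_fst (μ := μ) (ν := ν) |>.ae (Lp.coeFn_smul c ψ)
        filter_upwards [tensor_coeFn (c • ψ) χ, tensor_coeFn ψ χ,
          Lp.coeFn_smul c (tensor ψ χ), h] with z h1 h2 h3 h4
        simp only [RingHom.id_apply, h1, h3, Pi.smul_apply, h2, h4, smul_eq_mul, mul_assoc] }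
    ‖χ‖ (fun ψ => by simpa [mul_comm] using (norm_tensor ψ χ).le)

/-- The partial trace `Tr_{|χ⟩⟨χ|}[B]` of `B ∈ B(L²(μ) ⊗ L²(ν))` over the pure state `|χ⟩⟨χ|` of
`L²(ν)`: the operator `R` on `L²(μ)` with `⟪φ, R ψ⟫ = ⟪φ ⊗ χ, B (ψ ⊗ χ)⟫` for all `φ, ψ`, that is,
`Tr (R ρ) = Tr (B (ρ ⊗ |χ⟩⟨χ|))` for all `ρ` of trace class. -/
def partialTrace (χ : L2 ν) (B : L2 (μ.prod ν) →L[ℂ] L2 (μ.prod ν)) : L2 μ →L[ℂ] L2 μ :=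
  (tensorRight χ).adjoint ∘L B ∘L tensorRight χ

theorem inner_partialTrace (χ : L2 ν) (B : L2 (μ.prod ν) →L[ℂ] L2 (μ.prod ν)) (φ ψ : L2 μ) :
    ⟪φ, partialTrace χ B ψ⟫_ℂ = ⟪tensor φ χ, B (tensor ψ χ)⟫_ℂ :=
  ContinuousLinearMap.adjoint_inner_right (tensorRight χ) φ (B (tensor ψ χ))

end LTwo

/-! ### Processes with stationary independent increments, and their two-sided extension -/

/-- The state space `ℝ^d`. -/
abbrev E (d : ℕ) : Type := EuclideanSpace ℝ (Fin d)

/-- A Markov process on `ℝ^d` with stationary and independent increments, given as a process `X`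
on `Ω` with a family of laws: `law x` is the probability of the process started at `x`.  The
increments are independent, and the law of `X (s + t) - X s` depends neither on `s` nor on the
starting point.  Hence `X` is a Markov process under each `law x`, with transition function
`(x, A) ↦ law x {X t ∈ A}`. -/
structure IncrementProcess (d : ℕ) (Ω : Type*) [MeasurableSpace Ω] where
  law : Kernel (E d) Ω
  X : ℝ≥0 → Ω → E d
  isMarkovKernel : IsMarkovKernel law
  measurable : ∀ t, Measurable (X t)
  start : ∀ x, ∀ᵐ ω ∂(law x), X 0 ω = x
  indep : ∀ x, HasIndepIncrements X (law x)
  stationary : ∀ x s t, (law x).map (fun ω => X (s + t) ω - X s ω) =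
    (law 0).map (fun ω => X t ω - X 0 ω)

namespace IncrementProcess

variable {d : ℕ} {Ω : Type*} [MeasurableSpace Ω] (S : IncrementProcess d Ω)

instance : IsMarkovKernel S.law := S.isMarkovKernel

/-- The (infinite) measure `ℙ_μ = ∫ ℙ_x dμ(x)` of the process started from the Lebesgue
measure `μ`. -/
def lawLebesgue : Measure Ω := (volume : Measure (E d)).bind S.law

/-- `(P_t)` is the transition semigroup of the process: `P_t f (x) = 𝔼_x [f (X_t)]` for almost
all `x`. -/
def IsTransitionSemigroup
    (P : ℝ≥0 → (LInf (volume : Measure (E d)) →L[ℂ] LInf (volume : Measure (E d)))) : Prop :=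
  ∀ t (f : LInf (volume : Measure (E d))),
    P t f =ᵐ[volume] fun x => ∫ ω, f (S.X t ω) ∂(S.law x)

/-- `𝔼_μ |ψ(X_t) - ψ(X_0)|² → 0` as `t → 0`, for all `ψ ∈ L²(μ)`, with `μ` the Lebesgue
measure. -/
def ContinuityCondition : Prop :=
  ∀ ψ : L2 (volume : Measure (E d)),
    Tendsto (fun t => ∫⁻ ω, ‖ψ (S.X t ω) - ψ (S.X 0 ω)‖ₑ ^ 2 ∂S.lawLebesgue) (𝓝 0) (𝓝 0)

end IncrementProcess

/-- `(P_t)` preserves the Lebesgue measure `μ`: `∫ P_t f dμ = ∫ f dμ` for all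
`f ∈ L¹(μ) ∩ L^∞(μ)`. -/
def PreservesLebesgue {d : ℕ}
    (P : ℝ≥0 → (LInf (volume : Measure (E d)) →L[ℂ] LInf (volume : Measure (E d)))) : Prop :=
  ∀ t (f : LInf (volume : Measure (E d))), Integrable f volume →
    Integrable (P t f) volume ∧ ∫ x, P t f x = ∫ x, f x

/-- The space of two-sided paths in `ℝ^d` that vanish at time `0`, with the `σ`-algebra generated
by the coordinates. -/
abbrev PathSpace (d : ℕ) : Type := {w : ℝ → E d // w 0 = 0}

/-- The shift `η_t w = (w_{t+s} - w_t)_s` of two-sided paths. -/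
def pathShift {d : ℕ} (t : ℝ) (w : PathSpace d) : PathSpace d :=
  ⟨fun s => w.1 (t + s) - w.1 t, by simp⟩

/-- The shift `θ_t (x, w) = (x + w_t, η_t w)`. -/
def shift {d : ℕ} (t : ℝ) (z : E d × PathSpace d) : E d × PathSpace d :=
  (z.1 + z.2.1 t, pathShift t z.2)

namespace IncrementProcess

variable {d : ℕ} {Ω : Type*} [MeasurableSpace Ω] (S : IncrementProcess d Ω)

/-- The two-sided path of increments, built from two samples of the process: `X_s - X_0` at times
`s ≥ 0` in the first sample, and `-(X_{-s} - X_0)` at times `s < 0` in the second one. -/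
def twoSidedPath (ω : Ω × Ω) : PathSpace d :=
  ⟨fun s => if 0 ≤ s then S.X s.toNNReal ω.1 - S.X 0 ω.1
    else -(S.X (-s).toNNReal ω.2 - S.X 0 ω.2), by simp⟩

theorem measurable_twoSidedPath : Measurable S.twoSidedPath := by
  refine Measurable.subtype_mk (measurable_pi_lambda _ fun s => ?_)
  by_cases hs : 0 ≤ s
  · simp only [hs, if_true]
    exact ((S.measurable _).comp measurable_fst).sub ((S.measurable _).comp measurable_fst)
  · simp only [hs, if_false]
    exact (((S.measurable _).comp measurable_snd).sub ((S.measurable _).comp measurable_snd)).neg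

/-- The law of the two-sided process with the same stationary independent increments, which
vanishes at time `0`; its two halves are built from independent copies of the process. -/
def twoSidedLaw : Measure (PathSpace d) := ((S.law 0).prod (S.law 0)).map S.twoSidedPath

instance : IsProbabilityMeasure S.twoSidedLaw :=
  Measure.isProbabilityMeasure_map S.measurable_twoSidedPath.aemeasurable

/-- The measure `μ ⊗ ν` on `ℝ^d × F`, for `F` the path space with the two-sided law `ν`. -/
abbrev totalMeasure : Measure (E d × PathSpace d) :=
  (volume : Measure (E d)).prod S.twoSidedLaw

/-- The vector `1 ∈ L²(ν)`. -/
def oneVec : L2 S.twoSidedLaw := Lp.const 2 S.twoSidedLaw (1 : ℂ)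

end IncrementProcess

/-- `U` is the operator of composition with `T` on `L²(μ)`, i.e. `U h = h ∘ T`. -/
def IsComposition {α : Type*} [MeasurableSpace α] {μ : Measure α} (U : L2 μ →L[ℂ] L2 μ)
    (T : α → α) : Prop :=
  ∀ h : L2 μ, U h =ᵐ[μ] h ∘ T

end SubclassicalExtension

end

/-! Everything reduces to one computation. `U t` composes with θ_{-t} and the adjoint of `Θ t`
composes with id × η_{-t}, so V_t(ψ ⊗ 1)(x, w) = ψ(x + b_t(w)) with b_t(w) = w_{-2t} - w_{-t}
(`star_comp_tensor_oneVec`). Under ν, b_t has the law λ_t of -(X_t - X_0). Hence, with τ_y the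
translation by y, ⟪φ, 𝒫_t(X) ψ⟫ = ∫ ⟪τ_y φ, X τ_y ψ⟫ dλ_t(y) (`inner_quantumExt`): 𝒫_t averages the
conjugations by translations. The semigroup law is λ_{s+t} = λ_s * λ_t, and for X = M_f the
conjugation translates f, so that the average is P_t f.

Complete positivity and normality come from the form W*(X ⊗ I)W with W an isometry. Here X ⊗ I acts
by X on each summand L²(μ) ⊗ e_i, for a Hilbert basis (e_i) of L²(ν). That it acts fiber by fiber on
W ψ is checked for simple b_t, where W ψ is a finite sum of elementary tensors, and extended by
approximation (`inner_ampliation_spread`).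

Under (B), Jensen's inequality makes the mean of ‖τ_y ψ - ψ‖ under λ_t tend to 0. This gives weak
continuity at 0; the semigroup law and contractivity spread it to all times, and a dominated series
gives weak* continuity.

Invariance of ν under η_t holds because the two-sided path, seen from any past time -N, has
stationary independent increments with a law not depending on N (`map_fromPast_eq`). -/

noncomputable section

namespace SubclassicalExtension

/-! ### / Increment laws of the process and of the two-sided path / -/

namespace IncrementProcess

variable {d : ℕ} {Ω : Type*} [MeasurableSpace Ω] (S : IncrementProcess d Ω)

/-- The law of the increments `X_t - X_0`. -/
def incrLaw (t : ℝ≥0) : Measure (E d) := (S.law 0).map (fun ω => S.X t ω - S.X 0 ω)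

theorem measurable_sub (s t : ℝ≥0) : Measurable (fun ω => S.X s ω - S.X t ω) :=
  (S.measurable s).sub (S.measurable t)

instance (t : ℝ≥0) : IsProbabilityMeasure (S.incrLaw t) :=
  Measure.isProbabilityMeasure_map (S.measurable_sub _ _).aemeasurable

theorem map_sub_of_le (x : E d) {s t : ℝ≥0} (h : s ≤ t) :
    (S.law x).map (fun ω => S.X t ω - S.X s ω) = S.incrLaw (t - s) := by
  have := S.stationary x s (t - s)
  rwa [add_tsub_cancel_of_le h] at this

theorem incrLaw_zero : S.incrLaw 0 = Measure.dirac 0 := by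
  simp [incrLaw]

theorem incrLaw_add (s t : ℝ≥0) :
    S.incrLaw (s + t) = Measure.conv (S.incrLaw s) (S.incrLaw t) := by
  have h := (S.indep 0).indepFun_sub_sub (zero_le (a := s)) (le_self_add (a := s) (b := t))
  have h2 := h.map_add_eq_map_conv_map (S.measurable_sub _ _) (S.measurable_sub _ _)
  rw [S.stationary 0 s t] at h2
  refine Eq.trans ?_ h2
  rw [incrLaw]
  congr 1
  ext1 ω
  simp

/-- The joint law of the increments of `Y` over consecutive intervals is the product of the laws of
the increments of the process `S`. -/
def HasIncrements {Ω' : Type*} [MeasurableSpace Ω'] (Y : ℝ≥0 → Ω' → E d) (P : Measure Ω') : Prop :=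
  ∀ n (u : Fin (n + 1) → ℝ≥0), Monotone u →
    P.map (fun ω (i : Fin n) => Y (u i.succ) ω - Y (u i.castSucc) ω) =
      Measure.pi fun i => S.incrLaw (u i.succ - u i.castSucc)

theorem hasIncrements : S.HasIncrements S.X (S.law 0) := by
  intro n u hu
  have h := S.indep 0 n u hu
  rw [iIndepFun_iff_map_fun_eq_pi_map (fun i => (S.measurable_sub _ _).aemeasurable)] at h
  rw [h]
  congr 1
  ext1 i
  exact S.map_sub_of_le 0 (hu (Fin.castSucc_le_succ i))

/-- The second sample is run backwards from time N. Independence needs an increasing grid, so the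
times N - u are enumerated through `Fin.rev` and the independent family is then reindexed back. -/
theorem hasIncrements_reverse (N : ℝ≥0) (n : ℕ) (u : Fin (n + 1) → ℝ≥0) (hu : Monotone u) :
    (S.law 0).map (fun ω (i : Fin n) =>
      S.X (N - u i.castSucc) ω - S.X (N - u i.succ) ω) =
      Measure.pi fun i => S.incrLaw ((N - u i.castSucc) - (N - u i.succ)) := by
  have hv : Monotone fun j : Fin (n + 1) => N - u j.rev := fun i j hij =>
    tsub_le_tsub_left (hu (Fin.rev_le_rev.2 hij)) N
  have h := (S.indep 0 n _ hv).precomp Fin.rev_injective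
  rw [iIndepFun_iff_map_fun_eq_pi_map (fun i => (S.measurable_sub _ _).aemeasurable)] at h
  simp only [Fin.rev_succ, Fin.rev_castSucc, Fin.rev_rev] at h
  rw [h]
  congr 1
  ext1 i
  exact S.map_sub_of_le 0 (tsub_le_tsub_left (hu (Fin.castSucc_le_succ i)) N)

/-- The increments of the two-sided path from time `-N` on. -/
def fromPast (N : ℝ≥0) (u : ℝ≥0) (ω : Ω × Ω) : E d :=
  (S.X N ω.2 - S.X (N - u) ω.2) + (S.X (u - N) ω.1 - S.X 0 ω.1)

theorem measurable_fromPast (N u : ℝ≥0) : Measurable (S.fromPast N u) :=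
  ((S.measurable_sub _ _).comp measurable_snd).add ((S.measurable_sub _ _).comp measurable_fst)

theorem fromPast_zero (N : ℝ≥0) (ω : Ω × Ω) : S.fromPast N 0 ω = 0 := by
  simp [fromPast]

/-- Truncated subtraction merges the two cases: for u ≤ N the contribution of the first sample
vanishes, and for u ≥ N that of the second one is already complete. -/
theorem twoSidedPath_sub (N u : ℝ≥0) (ω : Ω × Ω) :
    (S.twoSidedPath ω).1 (u - N) - (S.twoSidedPath ω).1 (-N) = S.fromPast N u ω := by
  have hN : (S.twoSidedPath ω).1 (-N) = - (S.X N ω.2 - S.X 0 ω.2) := by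
    by_cases h : N = 0
    · simp [twoSidedPath, h]
    · have : ¬ (0 : ℝ) ≤ -N := by
        rw [not_le, neg_lt_zero]; exact NNReal.coe_pos.2 (pos_iff_ne_zero.2 h)
      simp only [twoSidedPath, this, if_false, neg_neg, Real.toNNReal_coe]
  rw [hN, fromPast]
  by_cases h : N ≤ u
  · have h1 : (0 : ℝ) ≤ u - N := sub_nonneg.2 (NNReal.coe_le_coe.2 h)
    have h2 : ((u : ℝ) - N).toNNReal = u - N := by
      rw [← NNReal.coe_sub h, Real.toNNReal_coe]
    simp only [twoSidedPath, h1, if_true, h2, tsub_eq_zero_of_le h]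
    abel
  · have h := (not_le.1 h)
    have h1 : ¬ (0 : ℝ) ≤ u - N := by
      rw [not_le, sub_neg]; exact NNReal.coe_lt_coe.2 h
    have h2 : (-((u : ℝ) - N)).toNNReal = N - u := by
      rw [neg_sub, ← NNReal.coe_sub h.le, Real.toNNReal_coe]
    simp only [twoSidedPath, h1, if_false, h2, tsub_eq_zero_of_le h.le]
    abel

/-- Each increment is a sum of a part before time 0, from the second sample, and a part after it,
from the first. These parts are independent, so their laws convolve, and the lengths of the two
pieces add up to the length of the interval. -/
theorem hasIncrements_fromPast (N : ℝ≥0) :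
    S.HasIncrements (S.fromPast N) ((S.law 0).prod (S.law 0)) := by
  intro n u hu
  let A : Ω → Fin n → E d := fun ω i => S.X (N - u i.castSucc) ω - S.X (N - u i.succ) ω
  let B : Ω → Fin n → E d := fun ω i => S.X (u i.succ - N) ω - S.X (u i.castSucc - N) ω
  have hA : Measurable A := measurable_pi_lambda _ fun i => S.measurable_sub _ _
  have hB : Measurable B := measurable_pi_lambda _ fun i => S.measurable_sub _ _
  have hBlaw := S.hasIncrements n (fun i => u i - N) (fun i j hij => tsub_le_tsub_right (hu hij) N)
  have hAlaw := S.hasIncrements_reverse N n u hu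
  have e1 : (fun ω (i : Fin n) => S.fromPast N (u i.succ) ω - S.fromPast N (u i.castSucc) ω) =
      (fun p : (Fin n → E d) × (Fin n → E d) => p.1 + p.2) ∘ Prod.map B A := by
    ext1 ω
    funext i
    simp only [fromPast, A, B, Function.comp, Prod.map, Pi.add_apply]
    abel
  have hadd : Measurable (fun p : (Fin n → E d) × (Fin n → E d) => p.1 + p.2) := by fun_prop
  -- Regrouping a pair of tuples as a tuple of pairs lets addition act coordinate by coordinate on a
  -- product measure.
  have hmp := measurePreserving_arrowProdEquivProdArrow (E d) (E d) (Fin n)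
    (fun i => S.incrLaw (u i.succ - N - (u i.castSucc - N)))
    (fun i => S.incrLaw ((N - u i.castSucc) - (N - u i.succ)))
  rw [e1, ← Measure.map_map hadd (hB.prodMap hA), ← Measure.map_prod_map _ _ hB hA]
  change (Measure.map _ ((Measure.map B (S.law 0)).prod (Measure.map A (S.law 0)))) = _
  rw [show Measure.map B (S.law 0) = _ from hBlaw, show Measure.map A (S.law 0) = _ from hAlaw,
    ← hmp.map_eq, Measure.map_map hadd hmp.measurable]
  have e2 : (fun p : (Fin n → E d) × (Fin n → E d) => p.1 + p.2) ∘
      (MeasurableEquiv.arrowProdEquivProdArrow (E d) (E d) (Fin n)) =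
      fun (f : Fin n → E d × E d) i => (f i).1 + (f i).2 := rfl
  rw [e2]
  have hm : ∀ i : Fin n, AEMeasurable (fun p : E d × E d => p.1 + p.2)
      ((S.incrLaw (u i.succ - N - (u i.castSucc - N))).prod
        (S.incrLaw ((N - u i.castSucc) - (N - u i.succ)))) :=
    fun i => (measurable_fst.add measurable_snd).aemeasurable
  have : ∀ i : Fin n, SigmaFinite (((S.incrLaw (u i.succ - N - (u i.castSucc - N))).prod
        (S.incrLaw ((N - u i.castSucc) - (N - u i.succ)))).map (fun p : E d × E d => p.1 + p.2)) :=
    fun i => by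
      have := Measure.isProbabilityMeasure_map (hm i)
      infer_instance
  refine (Measure.pi_map_pi hm).trans ?_
  congr 1
  ext1 i
  have hi : u i.castSucc ≤ u i.succ := hu (Fin.castSucc_le_succ i)
  have e3 : u i.succ - u i.castSucc =
      (u i.succ - N - (u i.castSucc - N)) + ((N - u i.castSucc) - (N - u i.succ)) := by
    rw [← NNReal.coe_inj]
    simp only [NNReal.coe_add, NNReal.coe_sub_def, NNReal.coe_sub hi]
    have hi' : (u i.castSucc : ℝ) ≤ u i.succ := hi
    grind
  rw [e3, incrLaw_add]
  rfl

/-- For a process vanishing at time 0, its values on a finite set of times are partial sums of its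
increments along the sorted set, and the law of the increments is prescribed. -/
theorem HasIncrements.map_restrict_eq {Ω' : Type*} [MeasurableSpace Ω'] {P : Measure Ω'}
    {Y Z : ℝ≥0 → Ω' → E d} (hY : S.HasIncrements Y P) (hZ : S.HasIncrements Z P)
    (mY : ∀ u, Measurable (Y u)) (mZ : ∀ u, Measurable (Z u))
    (hY0 : ∀ ω, Y 0 ω = 0) (hZ0 : ∀ ω, Z 0 ω = 0) (I : Finset ℝ≥0) :
    P.map (fun ω => I.restrict (Y · ω)) = P.map (fun ω => I.restrict (Z · ω)) := by
  classical
  -- Time 0 is added so that the partial sums start from a known value.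
  set J : Finset ℝ≥0 := insert 0 I with hJ
  obtain ⟨n, hn⟩ : ∃ n, J.card = n + 1 :=
    ⟨J.card - 1, (Nat.succ_pred_eq_of_pos (Finset.card_pos.2 ⟨0, by simp [hJ]⟩)).symm⟩
  let u : Fin (n + 1) → ℝ≥0 := J.orderEmbOfFin hn
  have hu : Monotone u := (J.orderEmbOfFin hn).monotone
  have hu_surj : ∀ s ∈ J, ∃ k, u k = s := fun s hs => by
    have : s ∈ Set.range (J.orderEmbOfFin hn) := by
      rw [Finset.range_orderEmbOfFin]; exact hs
    exact this
  have hu0 : u 0 = 0 := by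
    obtain ⟨k, hk⟩ := hu_surj 0 (by simp [hJ])
    exact le_antisymm (hk ▸ hu (Fin.zero_le k)) (zero_le)
  choose! k hk using hu_surj
  let G : (Fin n → E d) → (I → E d) := fun x s =>
    ∑ i : Fin n, if i.castSucc < k s then x i else 0
  have hG : Measurable G := by
    refine measurable_pi_lambda _ fun s => Finset.measurable_sum _ fun i _ => ?_
    split_ifs
    · exact measurable_pi_apply i
    · exact measurable_const
  have key : ∀ W : ℝ≥0 → Ω' → E d, (∀ ω, W 0 ω = 0) →
      (fun ω => I.restrict (W · ω)) =
        G ∘ (fun ω (i : Fin n) => W (u i.succ) ω - W (u i.castSucc) ω) := by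
    intro W hW
    have h : ∀ ω, ∀ m : Fin (n + 1), W (u m) ω =
        ∑ i : Fin n, if i.castSucc < m then W (u i.succ) ω - W (u i.castSucc) ω else 0 := by
      intro ω m
      induction m using Fin.induction with
      | zero => simp [hu0, hW]
      | succ j ih =>
        have h1 : ∀ i : Fin n, (if i.castSucc < j.succ then
              W (u i.succ) ω - W (u i.castSucc) ω else 0) =
            (if i.castSucc < j.castSucc then W (u i.succ) ω - W (u i.castSucc) ω else 0) +
            (if i = j then W (u i.succ) ω - W (u i.castSucc) ω else 0) := by
          intro i
          rcases lt_trichotomy i j with hij | hij | hij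
          · have a1 : i.castSucc < j.succ := Fin.lt_def.2 (by simp; omega)
            have a2 : i.castSucc < j.castSucc := by simpa using hij
            simp [a1, a2, hij.ne]
          · subst hij; simp
          · have a1 : ¬ i.castSucc < j.succ := by
              simp only [Fin.lt_def, Fin.val_castSucc, Fin.val_succ]; omega
            have a2 : ¬ i.castSucc < j.castSucc := by simpa using hij.le
            simp [a1, a2, hij.ne']
        rw [Finset.sum_congr rfl fun i _ => h1 i, Finset.sum_add_distrib, ← ih]
        simp
    ext1 ω
    funext s
    have hs : (s : ℝ≥0) ∈ J := by simp [hJ, s.2]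
    have := h ω (k s)
    rw [hk s hs] at this
    exact this
  have mI : ∀ W : ℝ≥0 → Ω' → E d, (∀ u, Measurable (W u)) →
      Measurable (fun ω (i : Fin n) => W (u i.succ) ω - W (u i.castSucc) ω) :=
    fun W hW => measurable_pi_lambda _ fun i => (hW _).sub (hW _)
  rw [key Y hY0, key Z hZ0, ← Measure.map_map hG (mI Y mY), ← Measure.map_map hG (mI Z mZ),
    hY n u hu, hZ n u hu]

theorem map_fromPast_eq (M N : ℝ≥0) :
    ((S.law 0).prod (S.law 0)).map (fun ω => (S.fromPast M · ω)) =
      ((S.law 0).prod (S.law 0)).map (fun ω => (S.fromPast N · ω)) := by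
  refine (map_eq_iff_forall_finset_map_restrict_eq
    (measurable_pi_lambda _ (S.measurable_fromPast M)).aemeasurable
    (measurable_pi_lambda _ (S.measurable_fromPast N)).aemeasurable).2 fun I => ?_
  exact HasIncrements.map_restrict_eq S (S.hasIncrements_fromPast M) (S.hasIncrements_fromPast N)
    (S.measurable_fromPast M) (S.measurable_fromPast N) (S.fromPast_zero M) (S.fromPast_zero N) I

end IncrementProcess

/-! ### / Shift invariance of the two-sided law / -/

variable {d : ℕ}

theorem measurable_coord (s : ℝ) : Measurable fun w : PathSpace d => w.1 s :=
  (measurable_pi_apply s).comp measurable_subtype_coe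

theorem measurable_pathShift (t : ℝ) : Measurable (pathShift (d := d) t) :=
  Measurable.subtype_mk (measurable_pi_lambda _ fun _ => (measurable_coord _).sub
    (measurable_coord _))

theorem measurableEmbedding_pathSpace :
    MeasurableEmbedding (Subtype.val : PathSpace d → ℝ → E d) :=
  MeasurableEmbedding.subtype_coe
    ((measurableSet_singleton (0 : E d)).preimage (measurable_pi_apply (0 : ℝ)))

/-- On finitely many times, the path and its shift are the same function of the path seen from -N
and from -(N - t) respectively, and these two views have the same law. -/
theorem IncrementProcess.measurePreserving_pathShift {Ω : Type*} [MeasurableSpace Ω]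
    (S : IncrementProcess d Ω) (t : ℝ) :
    MeasurePreserving (pathShift t) S.twoSidedLaw S.twoSidedLaw := by
  refine ⟨measurable_pathShift t, ?_⟩
  have hY : Measurable S.twoSidedPath := S.measurable_twoSidedPath
  have hemb := measurableEmbedding_pathSpace (d := d)
  suffices h : (S.twoSidedLaw.map (pathShift t)).map Subtype.val =
      S.twoSidedLaw.map (Subtype.val : PathSpace d → ℝ → E d) by
    rw [← hemb.comap_map (S.twoSidedLaw.map (pathShift t)), h, hemb.comap_map]
  rw [IncrementProcess.twoSidedLaw, Measure.map_map (measurable_pathShift t) hY,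
    Measure.map_map hemb.measurable ((measurable_pathShift t).comp hY),
    Measure.map_map hemb.measurable hY]
  refine (map_eq_iff_forall_finset_map_restrict_eq (T := ℝ) (𝓧 := fun _ => E d)
    (X := fun s ω => (pathShift t (S.twoSidedPath ω)).1 s)
    (Y := fun s ω => (S.twoSidedPath ω).1 s)
    (hemb.measurable.comp ((measurable_pathShift t).comp hY)).aemeasurable
    (hemb.measurable.comp hY).aemeasurable).2 fun I => ?_
  -- N is so large that N - t is still a nonnegative time and no time of `I` precedes -N.
  obtain ⟨N, hN⟩ : ∃ N : ℝ≥0, t ≤ N ∧ ∀ s ∈ I, 0 ≤ s + N := by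
    refine ⟨(|t| + ∑ s ∈ I, |s|).toNNReal, ?_⟩
    rw [Real.coe_toNNReal _ (by positivity)]
    refine ⟨?_, fun s hs => ?_⟩
    · have : 0 ≤ ∑ s ∈ I, |s| := by positivity
      linarith [le_abs_self t]
    · have := Finset.single_le_sum (f := fun s : ℝ => |s|) (fun _ _ => abs_nonneg _) hs
      linarith [neg_abs_le s, abs_nonneg t]
  obtain ⟨M, hM⟩ : ∃ M : ℝ≥0, (M : ℝ) = N - t := ⟨⟨N - t, sub_nonneg.2 hN.1⟩, rfl⟩
  let G : (ℝ≥0 → E d) → (I → E d) := fun x s => x (s + N : ℝ).toNNReal - x N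
  have hG : Measurable G :=
    measurable_pi_lambda _ fun s => (measurable_pi_apply _).sub (measurable_pi_apply _)
  have e1 : (fun ω => I.restrict fun s => (pathShift t (S.twoSidedPath ω)).1 s) =
      G ∘ fun ω => (S.fromPast M · ω) := by
    ext1 ω
    funext s
    have hs := hN.2 s s.2
    simp only [G, Function.comp, ← S.twoSidedPath_sub, Real.coe_toNNReal _ hs, hM,
      Finset.restrict, pathShift]
    rw [sub_sub_sub_cancel_right, show (s : ℝ) + N - (N - t) = t + s by ring, sub_sub_cancel]
  have e2 : (fun ω => I.restrict fun s => (S.twoSidedPath ω).1 s) =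
      G ∘ fun ω => (S.fromPast N · ω) := by
    ext1 ω
    funext s
    have hs := hN.2 s s.2
    simp only [G, Function.comp, ← S.twoSidedPath_sub, Real.coe_toNNReal _ hs,
      Finset.restrict, sub_sub_sub_cancel_right, sub_self, add_sub_cancel_right,
      (S.twoSidedPath ω).2, sub_zero]
  rw [e1, e2, ← Measure.map_map hG (measurable_pi_lambda _ (S.measurable_fromPast M)),
    ← Measure.map_map hG (measurable_pi_lambda _ (S.measurable_fromPast N)),
    S.map_fromPast_eq M N]

/-! ### / The shift groups and one-time marginals / -/

section Shifts

variable {d : ℕ}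

theorem pathShift_zero (w : PathSpace d) : pathShift 0 w = w := by
  ext1
  funext s
  simp [pathShift, w.2]

theorem pathShift_add (s t : ℝ) (w : PathSpace d) :
    pathShift (s + t) w = pathShift s (pathShift t w) := by
  ext1
  funext u
  simp only [pathShift, sub_sub_sub_cancel_right]
  rw [show s + t + u = t + (s + u) by ring, add_comm s t]

theorem shift_zero (z : E d × PathSpace d) : shift 0 z = z := by
  simp [shift, pathShift_zero, z.2.2]

theorem shift_add (s t : ℝ) (z : E d × PathSpace d) :
    shift (s + t) z = shift s (shift t z) := by
  simp only [shift, pathShift_add, Prod.mk.injEq, and_true]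
  simp only [pathShift, add_comm s t]
  abel

namespace IncrementProcess

variable {Ω : Type*} [MeasurableSpace Ω] (S : IncrementProcess d Ω)

/-- θ_t is a skew product over η_t whose fiber maps are translations, which preserve Lebesgue
measure. The factors are swapped to put the base first. -/
theorem measurePreserving_shift (t : ℝ) :
    MeasurePreserving (shift t) S.totalMeasure S.totalMeasure := by
  have h : MeasurePreserving (fun p : PathSpace d × E d => (pathShift t p.1, p.2 + p.1.1 t))
      (S.twoSidedLaw.prod volume) (S.twoSidedLaw.prod volume) := by
    refine (S.measurePreserving_pathShift t).skew_product
      (g := fun (w : PathSpace d) (x : E d) => x + w.1 t) ?_ ?_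
    · exact measurable_snd.add ((measurable_coord t).comp measurable_fst)
    · exact Eventually.of_forall fun w => (measurePreserving_add_right volume (w.1 t)).map_eq
  exact (Measure.measurePreserving_swap (μ := S.twoSidedLaw) (ν := volume)).comp
    (h.comp (Measure.measurePreserving_swap (μ := volume) (ν := S.twoSidedLaw)))

theorem map_coord (t : ℝ≥0) :
    S.twoSidedLaw.map (fun w => w.1 t) = S.incrLaw t := by
  rw [twoSidedLaw, Measure.map_map (measurable_coord _) S.measurable_twoSidedPath]
  have : (fun w : PathSpace d => w.1 t) ∘ S.twoSidedPath =
      (fun ω => S.X t ω - S.X 0 ω) ∘ Prod.fst := by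
    ext1 ω
    simp [twoSidedPath]
  rw [this, ← Measure.map_map (S.measurable_sub _ _) measurable_fst,
    measurePreserving_fst.map_eq]
  rfl

/-- The increment over `[-2t, -t]`, backwards in time. -/
def backIncr (t : ℝ≥0) (w : PathSpace d) : E d := w.1 (-t + -t) - w.1 (-t)

theorem measurable_backIncr (t : ℝ≥0) : Measurable (backIncr (d := d) t) :=
  (measurable_coord _).sub (measurable_coord _)

/-- The law of `X_0 - X_t`. -/
def backLaw (t : ℝ≥0) : Measure (E d) := (S.incrLaw t).map Neg.neg

instance (t : ℝ≥0) : IsProbabilityMeasure (S.backLaw t) :=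
  Measure.isProbabilityMeasure_map measurable_neg.aemeasurable

/-- Seen from time -2t, this variable is minus the value of the path at time t, so shift invariance
applies. -/
theorem map_backIncr (t : ℝ≥0) : S.twoSidedLaw.map (backIncr t) = S.backLaw t := by
  have h : backIncr (d := d) t = Neg.neg ∘ (fun w => w.1 t) ∘ pathShift (-(t : ℝ) + -t) := by
    ext1 w
    simp only [backIncr, Function.comp, pathShift, neg_sub]
    rw [neg_add_cancel_right]
  rw [h, ← Measure.map_map measurable_neg ((measurable_coord _).comp (measurable_pathShift _)),
    ← Measure.map_map (measurable_coord _) (measurable_pathShift _),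
    (S.measurePreserving_pathShift _).map_eq, S.map_coord, backLaw]

theorem backLaw_zero : S.backLaw 0 = Measure.dirac 0 := by
  rw [backLaw, incrLaw_zero, Measure.map_dirac' measurable_neg, neg_zero]

theorem backLaw_add (s t : ℝ≥0) :
    S.backLaw (s + t) = Measure.conv (S.backLaw s) (S.backLaw t) := by
  rw [backLaw, incrLaw_add]
  exact Measure.map_conv_addMonoidHom (negAddMonoidHom : E d →+ E d) measurable_neg

theorem map_X (x : E d) (t : ℝ≥0) :
    (S.law x).map (S.X t) = (S.incrLaw t).map (fun y => x + y) := by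
  have h : S.X t =ᵐ[S.law x] (fun y => x + y) ∘ fun ω => S.X t ω - S.X 0 ω := by
    filter_upwards [S.start x] with ω hω
    simp [hω]
  have h2 := S.stationary x 0 t
  rw [zero_add] at h2
  rw [Measure.map_congr h, ← Measure.map_map (measurable_const_add x) (S.measurable_sub _ _), h2]
  rfl

theorem integral_incrLaw_eq_backLaw {F : Type*} [NormedAddCommGroup F] [NormedSpace ℝ F]
    (t : ℝ≥0) (f : E d → F) : ∫ y, f y ∂S.incrLaw t = ∫ y, f (-y) ∂S.backLaw t := by
  have h := (MeasurableEquiv.neg (E d)).measurableEmbedding.integral_map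
    (μ := S.incrLaw t) (fun y => f (-y))
  simp only [MeasurableEquiv.neg_apply, neg_neg] at h
  exact h.symm

theorem lintegral_incrLaw_eq_backLaw (t : ℝ≥0) (f : E d → ℝ≥0∞) :
    ∫⁻ y, f y ∂S.incrLaw t = ∫⁻ y, f (-y) ∂S.backLaw t := by
  have h := (MeasurableEquiv.neg (E d)).measurableEmbedding.lintegral_map
    (μ := S.incrLaw t) (fun y => f (-y))
  simp only [MeasurableEquiv.neg_apply, neg_neg] at h
  exact h.symm

end IncrementProcess

end Shifts

/-! ### / Unitary groups of composition operators / -/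

section Composition

variable {α : Type*} [MeasurableSpace α] {μ : Measure α}

theorem IsComposition.ext {U V : L2 μ →L[ℂ] L2 μ} {T : α → α} (hU : IsComposition U T)
    (hV : IsComposition V T) : U = V := by
  ext1 h
  exact Lp.ext ((hU h).trans (hV h).symm)

/-- Composition with a measure-preserving map is an isometry; the group law makes it invertible,
hence unitary. Composition reverses products, which is harmless because ℝ is commutative. -/
theorem exists_isUnitaryGroup_isComposition (T : ℝ → α → α) (hT : ∀ t, MeasurePreserving (T t) μ μ)
    (h0 : ∀ x, T 0 x = x) (hadd : ∀ s t x, T (s + t) x = T s (T t x)) :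
    ∃ U : ℝ → unitary (L2 μ →L[ℂ] L2 μ), IsUnitaryGroup U ∧
      ∀ t, IsComposition (U t : L2 μ →L[ℂ] L2 μ) (T t) := by
  let A : ℝ → L2 μ →L[ℂ] L2 μ := fun t =>
    (Lp.compMeasurePreservingₗᵢ ℂ (T t) (hT t)).toContinuousLinearMap
  have hA : ∀ t, IsComposition (A t) (T t) := fun t h => Lp.coeFn_compMeasurePreserving h (hT t)
  have hA0 : A 0 = 1 := by
    refine (hA 0).ext fun h => ?_
    exact Eventually.of_forall fun x => by simp [h0]
  have hAadd : ∀ s t, A (s + t) = A s * A t := by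
    intro s t
    refine (hA _).ext fun h => ?_
    filter_upwards [hA s (A t h), (hT s).quasiMeasurePreserving.ae (hA t h)] with x h1 h2
    rw [mul_apply_eq_comp, h1, Function.comp_apply, h2, Function.comp_apply,
      Function.comp_apply, add_comm, hadd]
  have hstar : ∀ t, star (A t) * A t = 1 := fun t =>
    (ContinuousLinearMap.norm_map_iff_adjoint_comp_self (A t)).1
      (Lp.compMeasurePreservingₗᵢ ℂ (T t) (hT t)).norm_map
  have hinv : ∀ t, A t * A (-t) = 1 := fun t => by rw [← hAadd, add_neg_cancel, hA0]
  have hstar' : ∀ t, star (A t) = A (-t) := fun t =>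
    left_inv_eq_right_inv (hstar t) (hinv t)
  refine ⟨fun t => ⟨A t, Unitary.mem_iff.2 ⟨hstar t, by rw [hstar', hinv]⟩⟩, ⟨?_, ?_⟩, hA⟩
  · exact Subtype.ext hA0
  · exact fun s t => Subtype.ext (hAadd s t)

end Composition

/-! ### / Ampliation of an operator to a Hilbert sum of copies / -/

section Diagonal

variable {ι H G : Type*} [NormedAddCommGroup H] [InnerProductSpace ℂ H]
  [NormedAddCommGroup G] [InnerProductSpace ℂ G] [CompleteSpace G]

theorem memℓp_map (X : H →L[ℂ] H) (f : lp (fun _ : ι => H) 2) :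
    Memℓp (fun i => X (f i)) 2 :=
  ((lp.memℓp f).const_smul (‖X‖ : ℂ)).mono' fun i => by
    simpa [norm_smul] using X.le_opNorm (f i)

/-- The operator on an `ℓ²` direct sum that acts by `X` on each summand. -/
def lpDiag (X : H →L[ℂ] H) : lp (fun _ : ι => H) 2 →L[ℂ] lp (fun _ : ι => H) 2 :=
  LinearMap.mkContinuous
    { toFun := fun f => ⟨fun i => X (f i), memℓp_map X f⟩
      map_add' := fun f g => by ext i; exact map_add X _ _
      map_smul' := fun c f => by ext i; exact map_smul X _ _ }
    ‖X‖ fun f => by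
      have h := lp.norm_mono (p := 2) (by norm_num)
        (x := (⟨fun i => X (f i), memℓp_map X f⟩ : lp (fun _ : ι => H) 2))
        (y := (‖X‖ : ℂ) • f) fun i => by
          change ‖X (f i)‖ ≤ ‖(‖X‖ : ℂ) • f i‖
          rw [norm_smul, Complex.norm_real, norm_norm]
          exact X.le_opNorm (f i)
      rwa [norm_smul, Complex.norm_real, norm_norm] at h

theorem lpDiag_apply (X : H →L[ℂ] H) (f : lp (fun _ : ι => H) 2) (i : ι) :
    lpDiag X f i = X (f i) := rfl

variable [CompleteSpace H] {V : ι → H →ₗᵢ[ℂ] G}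

/-- With the coordinates of a vector written as adjoints, identities for the ampliation can be
checked coordinate by coordinate (`adjoint_ampliation`, `ext_adjoint`). -/
theorem _root_.IsHilbertSum.linearIsometryEquiv_apply_eq_adjoint
    (hV : IsHilbertSum ℂ (fun _ => H) V) (ξ : G) (i : ι) :
    hV.linearIsometryEquiv ξ i = (V i).toContinuousLinearMap.adjoint ξ := by
  classical
  refine ext_inner_left ℂ fun a => ?_
  rw [ContinuousLinearMap.adjoint_inner_right]
  refine (lp.inner_single_left (𝕜 := ℂ) (G := fun _ : ι => H) i a _).symm.trans ?_
  change _ = ⟪V i a, ξ⟫_ℂ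
  rw [← hV.linearIsometryEquiv_symm_apply_single, ← hV.linearIsometryEquiv.inner_map_map (hV.linearIsometryEquiv.symm _) ξ,
    LinearIsometryEquiv.apply_symm_apply]

/-- The operator on a Hilbert sum of copies of `H` that acts by `X` on each summand. -/
def ampliation (hV : IsHilbertSum ℂ (fun _ => H) V) (X : H →L[ℂ] H) : G →L[ℂ] G :=
  hV.linearIsometryEquiv.symm.toLinearIsometry.toContinuousLinearMap ∘L lpDiag X ∘L
    hV.linearIsometryEquiv.toLinearIsometry.toContinuousLinearMap

theorem hasSum_inner_adjoint (hV : IsHilbertSum ℂ (fun _ => H) V) (ξ ζ : G) :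
    HasSum (fun i => ⟪(V i).toContinuousLinearMap.adjoint ξ,
      (V i).toContinuousLinearMap.adjoint ζ⟫_ℂ) ⟪ξ, ζ⟫_ℂ := by
  rw [← hV.linearIsometryEquiv.inner_map_map]
  simp only [← hV.linearIsometryEquiv_apply_eq_adjoint]
  exact lp.hasSum_inner _ _

variable (hV : IsHilbertSum ℂ (fun _ => H) V)

theorem adjoint_ampliation (X : H →L[ℂ] H) (ξ : G) (i : ι) :
    (V i).toContinuousLinearMap.adjoint (ampliation hV X ξ) =
      X ((V i).toContinuousLinearMap.adjoint ξ) := by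
  rw [← hV.linearIsometryEquiv_apply_eq_adjoint, ← hV.linearIsometryEquiv_apply_eq_adjoint]
  simp [ampliation, lpDiag_apply]

theorem ext_adjoint (hV : IsHilbertSum ℂ (fun _ => H) V) {ξ ζ : G} (h : ∀ i, (V i).toContinuousLinearMap.adjoint ξ =
    (V i).toContinuousLinearMap.adjoint ζ) : ξ = ζ := by
  refine hV.linearIsometryEquiv.injective ?_
  ext i
  simp only [hV.linearIsometryEquiv_apply_eq_adjoint, h]

theorem hasSum_inner_ampliation (X : H →L[ℂ] H) (ξ ζ : G) :
    HasSum (fun i => ⟪(V i).toContinuousLinearMap.adjoint ξ,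
      X ((V i).toContinuousLinearMap.adjoint ζ)⟫_ℂ) ⟪ξ, ampliation hV X ζ⟫_ℂ := by
  simpa only [adjoint_ampliation] using hasSum_inner_adjoint hV ξ (ampliation hV X ζ)

theorem ampliation_add (X Y : H →L[ℂ] H) :
    ampliation hV (X + Y) = ampliation hV X + ampliation hV Y := by
  ext1 ξ
  exact ext_adjoint hV fun i => by simp [adjoint_ampliation]

theorem ampliation_smul (c : ℂ) (X : H →L[ℂ] H) :
    ampliation hV (c • X) = c • ampliation hV X := by
  ext1 ξ
  exact ext_adjoint hV fun i => by simp [adjoint_ampliation]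

theorem ampliation_mul (X Y : H →L[ℂ] H) :
    ampliation hV (X * Y) = ampliation hV X * ampliation hV Y := by
  ext1 ξ
  exact ext_adjoint hV fun i => by simp [adjoint_ampliation]

theorem ampliation_one : ampliation hV 1 = 1 := by
  ext1 ξ
  exact ext_adjoint hV fun i => by simp [adjoint_ampliation]

theorem inner_ampliation_star (X : H →L[ℂ] H) (ξ ζ : G) :
    ⟪ξ, ampliation hV (star X) ζ⟫_ℂ = ⟪ampliation hV X ξ, ζ⟫_ℂ := by
  refine (hasSum_inner_ampliation hV (star X) ξ ζ).unique ?_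
  have h := hasSum_inner_adjoint hV (ampliation hV X ξ) ζ
  simpa only [adjoint_ampliation, ContinuousLinearMap.star_eq_adjoint,
    ContinuousLinearMap.adjoint_inner_right] using h

end Diagonal

/-! ### / L²(μ ⊗ ν) as a Hilbert sum of copies of L²(μ) / -/

section Tensor

variable {α β : Type*} [MeasurableSpace α] [MeasurableSpace β] {μ : Measure α} {ν : Measure β}
  [SFinite μ] [SFinite ν]

theorem inner_tensor (ψ ψ' : L2 μ) (φ φ' : L2 ν) :
    ⟪tensor ψ φ, tensor ψ' φ'⟫_ℂ = ⟪ψ, ψ'⟫_ℂ * ⟪φ, φ'⟫_ℂ := by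
  rw [L2.inner_def, L2.inner_def, L2.inner_def, ← integral_prod_mul]
  refine integral_congr_ae ?_
  filter_upwards [tensor_coeFn ψ φ, tensor_coeFn ψ' φ'] with z h1 h2
  rw [h1, h2]
  simp only [RCLike.inner_apply, map_mul]
  ring

theorem tensorRight_apply (χ : L2 ν) (ψ : L2 μ) : tensorRight χ ψ = tensor ψ χ := rfl

theorem adjoint_tensorRight_tensor (χ φ : L2 ν) (ψ : L2 μ) :
    (tensorRight χ).adjoint (tensor ψ φ) = ⟪χ, φ⟫_ℂ • ψ := by
  refine ext_inner_left ℂ fun a => ?_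
  rw [ContinuousLinearMap.adjoint_inner_right, tensorRight_apply, inner_tensor, inner_smul_right,
    mul_comm]

/-- Testing against indicators shows that h integrates to 0 over rectangles. On a slab of finite
measure the π-λ theorem extends this to all measurable sets, so h = 0 there, and countably many
slabs cover the space. -/
theorem eq_zero_of_inner_tensor {μ : Measure α} [SigmaFinite μ] {ν : Measure β} [IsFiniteMeasure ν]
    (h : L2 (μ.prod ν)) (hh : ∀ (ψ : L2 μ) (φ : L2 ν), ⟪tensor ψ φ, h⟫_ℂ = 0) : h = 0 := by
  have hint : ∀ s : Set (α × β), MeasurableSet s → (μ.prod ν) s < ∞ →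
      IntegrableOn h s (μ.prod ν) := fun s _ hs' =>
    integrableOn_Lp_of_measure_ne_top h (by norm_num) hs'.ne
  have hrect : ∀ (A : Set α) (B : Set β), MeasurableSet A → MeasurableSet B → μ A < ∞ →
      ∫ z in A ×ˢ B, h z ∂(μ.prod ν) = 0 := by
    intro A B hA hB hμA
    rw [← hh (indicatorConstLp 2 hA hμA.ne 1) (indicatorConstLp 2 hB (measure_ne_top ν B) 1),
      L2.inner_def, ← integral_indicator (hA.prod hB)]
    refine integral_congr_ae ?_
    filter_upwards [tensor_coeFn (indicatorConstLp 2 hA hμA.ne (1 : ℂ))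
      (indicatorConstLp 2 hB (measure_ne_top ν B) (1 : ℂ)),
      (Measure.quasiMeasurePreserving_fst (μ := μ) (ν := ν)).ae
        (indicatorConstLp_coeFn (p := 2) (hs := hA) (hμs := hμA.ne) (c := (1 : ℂ))),
      (Measure.quasiMeasurePreserving_snd (μ := μ) (ν := ν)).ae
        (indicatorConstLp_coeFn (p := 2) (hs := hB) (hμs := measure_ne_top ν B) (c := (1 : ℂ)))]
      with z h1 h2 h3
    rw [h1, h2, h3]
    by_cases hzA : z.1 ∈ A <;> by_cases hzB : z.2 ∈ B <;>
      simp [Set.indicator, Set.mem_prod, hzA, hzB]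
  have hslab : ∀ n, h =ᵐ[(μ.prod ν).restrict (spanningSets μ n ×ˢ Set.univ)] 0 := by
    intro n
    set R : Set (α × β) := spanningSets μ n ×ˢ Set.univ with hR
    have hS := measurableSet_spanningSets μ n
    have hRm : MeasurableSet R := hS.prod MeasurableSet.univ
    have hRlt : (μ.prod ν) R < ∞ := by
      rw [hR, Measure.prod_prod]
      exact ENNReal.mul_lt_top (measure_spanningSets_lt_top μ n) (measure_lt_top ν _)
    have hRint : IntegrableOn h R (μ.prod ν) := hint R hRm hRlt
    refine Integrable.ae_eq_zero_of_forall_setIntegral_eq_zero hRint fun s hs hfin => ?_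
    clear hfin
    have htot : ∫ z in R, h z ∂(μ.prod ν) = 0 :=
      hrect _ _ hS MeasurableSet.univ (measure_spanningSets_lt_top μ n)
    induction s, hs using MeasurableSpace.induction_on_inter
      generateFrom_prod.symm isPiSystem_prod with
    | empty => simp
    | basic t ht =>
      obtain ⟨A, hA, B, hB, rfl⟩ := ht
      rw [Measure.restrict_restrict (hA.prod hB), hR, Set.prod_inter_prod, Set.inter_univ]
      exact hrect _ _ (MeasurableSet.inter hA hS) hB
        ((measure_mono Set.inter_subset_right).trans_lt (measure_spanningSets_lt_top μ n))
    | compl t ht ih =>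
      have := integral_add_compl ht hRint
      rw [ih, zero_add, htot] at this
      exact this
    | iUnion f hd hf ih =>
      rw [integral_iUnion hf hd hRint.integrableOn]
      simp only [ih, tsum_zero]
  have hU : (⋃ n, spanningSets μ n ×ˢ (Set.univ : Set β)) = Set.univ := by
    rw [← Set.iUnion_prod_const, iUnion_spanningSets, Set.univ_prod_univ]
  refine Lp.ext ?_
  have h1 : h =ᵐ[(μ.prod ν).restrict (⋃ n, spanningSets μ n ×ˢ (Set.univ : Set β))] 0 :=
    (ae_restrict_iUnion_iff _ _).2 hslab
  rw [hU, Measure.restrict_univ] at h1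
  exact h1.trans (Lp.coeFn_zero ℂ 2 _).symm

/-- The operator `φ ↦ ψ ⊗ φ` from `L²(ν)` to `L²(μ ⊗ ν)`. -/
def tensorLeft (ψ : L2 μ) : L2 ν →L[ℂ] L2 (μ.prod ν) :=
  LinearMap.mkContinuous
    { toFun := fun φ => tensor ψ φ
      map_add' := fun φ₁ φ₂ => by
        refine Lp.ext ?_
        have h := Measure.quasiMeasurePreserving_snd (μ := μ) (ν := ν) |>.ae (Lp.coeFn_add φ₁ φ₂)
        filter_upwards [tensor_coeFn ψ (φ₁ + φ₂), tensor_coeFn ψ φ₁, tensor_coeFn ψ φ₂,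
          Lp.coeFn_add (tensor ψ φ₁) (tensor ψ φ₂), h] with z h1 h2 h3 h4 h5
        simp only [h1, h4, Pi.add_apply, h2, h3, h5, mul_add]
      map_smul' := fun c φ => by
        refine Lp.ext ?_
        have h := Measure.quasiMeasurePreserving_snd (μ := μ) (ν := ν) |>.ae (Lp.coeFn_smul c φ)
        filter_upwards [tensor_coeFn ψ (c • φ), tensor_coeFn ψ φ,
          Lp.coeFn_smul c (tensor ψ φ), h] with z h1 h2 h3 h4
        simp only [RingHom.id_apply, h1, h3, Pi.smul_apply, h2, h4, smul_eq_mul, mul_left_comm] }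
    ‖ψ‖ (fun φ => (norm_tensor ψ φ).le)

/-- The isometry `ψ ↦ ψ ⊗ χ`, for a unit vector `χ`. -/
def tensorIsometry (χ : L2 ν) (hχ : ‖χ‖ = 1) : L2 μ →ₗᵢ[ℂ] L2 (μ.prod ν) :=
  { (tensorRight χ : L2 μ →L[ℂ] L2 (μ.prod ν)).toLinearMap with
    norm_map' := fun ψ => by
      change ‖tensor ψ χ‖ = _
      rw [norm_tensor, hχ, mul_one] }

theorem tensorIsometry_toContinuousLinearMap (χ : L2 ν) (hχ : ‖χ‖ = 1) :
    (tensorIsometry (μ := μ) χ hχ).toContinuousLinearMap = tensorRight χ := rfl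

/-- For totality: if h is orthogonal to every ψ ⊗ e_i, then the vector of L²(ν) representing φ ↦ ⟪ψ
⊗ φ, h⟫ has no nonzero coefficient, so h is orthogonal to all elementary tensors. -/
theorem isHilbertSum_tensor {μ : Measure α} [SigmaFinite μ] {ν : Measure β} [IsFiniteMeasure ν]
    {ι : Type*} (e : HilbertBasis ι ℂ (L2 ν)) :
    IsHilbertSum ℂ (fun _ : ι => L2 μ)
      (fun i => tensorIsometry (μ := μ) (e i) (e.orthonormal.norm_eq_one i)) := by
  refine IsHilbertSum.mk (fun i j hij ψ ψ' => ?_) ?_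
  · change ⟪tensor ψ (e i), tensor ψ' (e j)⟫_ℂ = 0
    rw [inner_tensor, e.orthonormal.2 hij, mul_zero]
  · rw [top_le_iff, Submodule.topologicalClosure_eq_top_iff, Submodule.eq_bot_iff]
    intro h hh
    refine eq_zero_of_inner_tensor h fun ψ φ => ?_
    have h1 : (tensorLeft ψ).adjoint h = 0 := by
      refine e.repr.injective ?_
      ext i
      rw [e.repr_apply_apply, ContinuousLinearMap.adjoint_inner_right, map_zero]
      exact hh _ (Submodule.mem_iSup_of_mem i ⟨ψ, rfl⟩)
    change ⟪tensorLeft ψ φ, h⟫_ℂ = 0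
    rw [← ContinuousLinearMap.adjoint_inner_right, h1, inner_zero_right]

variable {μ : Measure α} [SigmaFinite μ] {ν : Measure β} [IsFiniteMeasure ν]

theorem ampliation_tensor {ι : Type*} (e : HilbertBasis ι ℂ (L2 ν)) (X : L2 μ →L[ℂ] L2 μ)
    (ψ : L2 μ) (φ : L2 ν) :
    ampliation (isHilbertSum_tensor e) X (tensor ψ φ) = tensor (X ψ) φ := by
  refine ext_adjoint (isHilbertSum_tensor e) fun i => ?_
  have h1 := adjoint_ampliation (isHilbertSum_tensor e) X (tensor ψ φ) i
  have h2 : ∀ ψ : L2 μ, (tensorRight (e i)).adjoint (tensor ψ φ) = ⟪e i, φ⟫_ℂ • ψ :=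
    adjoint_tensorRight_tensor (e i) φ
  rw [tensorIsometry_toContinuousLinearMap] at h1 ⊢
  rw [h1, h2, h2, map_smul]

end Tensor

/-! ### / Positivity of operator matrices through quadratic forms / -/

section NegPart

variable {B : Type*} [NonUnitalCStarAlgebra B] [PartialOrder B] [StarOrderedRing B]

theorem exists_eq_star_mul_self {a : B} (ha : 0 ≤ a) : ∃ b, a = star b * b :=
  CStarAlgebra.nonneg_iff_eq_star_mul_self.1 ha

/-- Take r to be the negative part of a, so that a r = -r², and t with t* t = r. -/
theorem exists_compression_of_isSelfAdjoint {a : B} (ha : IsSelfAdjoint a) :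
    ∃ r t : B, star r = r ∧ r = star t * t ∧ r * (a * r) = -(star (t * r) * (t * r)) ∧
      (r = 0 → 0 ≤ a) := by
  have hr0 : 0 ≤ a⁻ := CFC.negPart_nonneg a
  have hrsa : star a⁻ = a⁻ := (IsSelfAdjoint.of_nonneg hr0).star_eq
  obtain ⟨t, ht⟩ := CStarAlgebra.nonneg_iff_eq_star_mul_self.1 hr0
  have hdec : a⁺ - a⁻ = a := CFC.posPart_sub_negPart a ha
  refine ⟨a⁻, t, hrsa, ht, ?_, fun h => ?_⟩
  · have h1 : a * a⁻ = -(a⁻ * a⁻) := by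
      nth_rewrite 1 [← hdec]
      rw [sub_mul, CFC.posPart_mul_negPart, zero_sub]
    rw [h1, star_mul, hrsa, mul_neg]
    congr 1
    nth_rewrite 2 [ht]
    simp only [mul_assoc]
  · rw [← hdec, h, sub_zero]
    exact CFC.posPart_nonneg a

end NegPart

section Matrices

variable {H : Type*} [NormedAddCommGroup H] [InnerProductSpace ℂ H] {k : ℕ}

/-- The action of a matrix of operators on a tuple of vectors. -/
def matrixAct (M : CStarMatrix (Fin k) (Fin k) (H →L[ℂ] H)) (x : Fin k → H) (i : Fin k) : H :=
  ∑ j, M i j (x j)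

theorem matrixAct_mul (M N : CStarMatrix (Fin k) (Fin k) (H →L[ℂ] H)) (x : Fin k → H) :
    matrixAct (M * N) x = matrixAct M (matrixAct N x) := by
  funext i
  simp only [matrixAct, CStarMatrix.mul_apply, sum_apply, map_sum,
    mul_apply_eq_comp]
  exact Finset.sum_comm

theorem matrixAct_neg (M : CStarMatrix (Fin k) (Fin k) (H →L[ℂ] H)) (x : Fin k → H) :
    matrixAct (-M) x = -matrixAct M x := by
  funext i
  simp [matrixAct]

theorem sum_inner_matrixAct [CompleteSpace H] (M : CStarMatrix (Fin k) (Fin k) (H →L[ℂ] H)) (x y : Fin k → H) :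
    ∑ i, ⟪x i, matrixAct M y i⟫_ℂ = ∑ i, ⟪matrixAct (star M) x i, y i⟫_ℂ := by
  simp only [matrixAct, inner_sum, sum_inner, CStarMatrix.star_apply,
    ContinuousLinearMap.star_eq_adjoint, ContinuousLinearMap.adjoint_inner_left]
  exact Finset.sum_comm

theorem eq_zero_of_matrixAct (M : CStarMatrix (Fin k) (Fin k) (H →L[ℂ] H))
    (h : ∀ x, matrixAct M x = 0) : M = 0 := by
  ext i j x
  have := congrFun (h (Pi.single j x)) i
  rw [matrixAct, Finset.sum_eq_single j] at this
  · simpa using this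
  · intro l _ hl
    simp [Pi.single_eq_of_ne hl]
  · simp

/-- Let R = T*T be the negative part of M. The quadratic form at R x equals -‖T R x‖², so T R = 0,
whence R*R = T*T R = 0 and M has no negative part. -/
theorem cstarMatrix_nonneg [CompleteSpace H] (M : CStarMatrix (Fin k) (Fin k) (H →L[ℂ] H)) (hM : IsSelfAdjoint M)
    (h : ∀ x : Fin k → H, 0 ≤ (∑ i, ⟪x i, matrixAct M x i⟫_ℂ).re) : 0 ≤ M := by
  obtain ⟨R, T, hRsa, hT, hRMR, hpos⟩ := exists_compression_of_isSelfAdjoint hM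
  have hTR : T * R = 0 := by
    refine eq_zero_of_matrixAct _ fun x => ?_
    have h1 := h (matrixAct R x)
    have h2 : ∑ i, ⟪matrixAct R x i, matrixAct M (matrixAct R x) i⟫_ℂ =
        -∑ i, ⟪matrixAct (T * R) x i, matrixAct (T * R) x i⟫_ℂ := by
      rw [← matrixAct_mul]
      nth_rewrite 1 [← hRsa]
      rw [← sum_inner_matrixAct, ← matrixAct_mul, hRMR, matrixAct_neg, matrixAct_mul]
      simp only [Pi.neg_apply, inner_neg_right, Finset.sum_neg_distrib]
      rw [sum_inner_matrixAct, star_star]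
    rw [h2, Complex.neg_re, Complex.re_sum] at h1
    have h3 : ∀ i, (⟪matrixAct (T * R) x i, matrixAct (T * R) x i⟫_ℂ).re =
        ‖matrixAct (T * R) x i‖ ^ 2 := fun i =>
      inner_self_eq_norm_sq (𝕜 := ℂ) (matrixAct (T * R) x i)
    simp only [h3] at h1
    have h4 : ∑ i, ‖matrixAct (T * R) x i‖ ^ 2 = 0 :=
      le_antisymm (by linarith) (Finset.sum_nonneg fun _ _ => sq_nonneg _)
    funext i
    have h5 := (Finset.sum_eq_zero_iff_of_nonneg fun _ _ => sq_nonneg _).1 h4 i (Finset.mem_univ i)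
    simpa using h5
  have hRR : star R * R = 0 := by
    rw [hRsa]
    nth_rewrite 1 [hT]
    rw [mul_assoc, hTR, mul_zero]
  exact hpos ((CStarRing.star_mul_self_eq_zero_iff R).1 hRR)

end Matrices

/-! ### / Continuity for the weak* topology / -/

section SigmaWeak

variable {H : Type*} [NormedAddCommGroup H] [InnerProductSpace ℂ H]

theorem summable_norm_sq {H : Type*} [NormedAddCommGroup H] (φ : lp (fun _ : ℕ => H) 2) : Summable fun n => ‖φ n‖ ^ 2 := by
  have h := (memℓp_gen_iff (p := 2) (by norm_num)).1 (lp.memℓp φ)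
  simpa using h

theorem summable_norm_sq_apply {G : Type*} [NormedAddCommGroup G] [InnerProductSpace ℂ G]
    (W : H →L[ℂ] G) (φ : lp (fun _ : ℕ => H) 2) : Summable fun n => ‖W (φ n)‖ ^ 2 := by
  refine Summable.of_nonneg_of_le (fun _ => sq_nonneg _) (fun n => ?_)
    ((summable_norm_sq φ).mul_left (‖W‖ ^ 2))
  rw [← mul_pow]
  exact pow_le_pow_left₀ (norm_nonneg _) (W.le_opNorm _) 2

theorem summable_inner_of_summable_sq {κ : Type*} {a b : κ → H}
    (ha : Summable fun k => ‖a k‖ ^ 2) (hb : Summable fun k => ‖b k‖ ^ 2) (X : H →L[ℂ] H) :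
    Summable fun k => ⟪a k, X (b k)⟫_ℂ := by
  refine Summable.of_norm_bounded ((ha.add hb).mul_left ‖X‖) fun k => ?_
  refine (norm_inner_le_norm _ _).trans ?_
  have h1 : ‖a k‖ * ‖X (b k)‖ ≤ ‖a k‖ * (‖X‖ * ‖b k‖) := by
    gcongr
    exact X.le_opNorm _
  have h2 : ‖a k‖ * ‖b k‖ ≤ ‖a k‖ ^ 2 + ‖b k‖ ^ 2 := by
    nlinarith [sq_nonneg (‖a k‖ - ‖b k‖), sq_nonneg (‖a k‖), sq_nonneg (‖b k‖)]
  calc ‖a k‖ * ‖X (b k)‖ ≤ ‖X‖ * (‖a k‖ * ‖b k‖) := by linarith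
    _ ≤ _ := by gcongr

theorem continuous_sigmaWeak_tsum_inner_nat (φ ψ : lp (fun _ : ℕ => H) 2) :
    Continuous[sigmaWeak H, inferInstance] fun X : H →L[ℂ] H => ∑' n, ⟪φ n, X (ψ n)⟫_ℂ :=
  continuous_iInf_dom (continuous_iInf_dom continuous_induced_dom)

theorem continuous_sigmaWeak_rng {Y : Type*} [TopologicalSpace Y] {f : Y → H →L[ℂ] H}
    (h : ∀ φ ψ : lp (fun _ : ℕ => H) 2, Continuous fun y => ∑' n, ⟪φ n, f y (ψ n)⟫_ℂ) :
    Continuous[inferInstance, sigmaWeak H] f :=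
  continuous_iInf_rng.2 fun φ => continuous_iInf_rng.2 fun ψ => continuous_induced_rng.2 (h φ ψ)

/-- Square-summable families have countable support, so they can be reindexed by ℕ and extended by
0. An arbitrary index set is allowed because L²(ν) is not assumed separable. -/
theorem continuous_sigmaWeak_tsum_inner {κ : Type*} {a b : κ → H}
    (ha : Summable fun k => ‖a k‖ ^ 2) (hb : Summable fun k => ‖b k‖ ^ 2) :
    Continuous[sigmaWeak H, inferInstance] fun X : H →L[ℂ] H => ∑' k, ⟪a k, X (b k)⟫_ℂ := by
  let s : Set κ := (Function.support fun k => ‖a k‖ ^ 2) ∪ (Function.support fun k => ‖b k‖ ^ 2)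
  have hs : s.Countable := ha.countable_support.union hb.countable_support
  have : Countable s := hs.to_subtype
  obtain ⟨f, hf⟩ := exists_injective_nat s
  have hext : ∀ {c : κ → H}, (Summable fun k => ‖c k‖ ^ 2) →
      Memℓp (Function.extend f (fun k : s => c k) 0) 2 := by
    intro c hc
    refine memℓp_gen ?_
    simp only [ENNReal.toReal_ofNat, Real.rpow_ofNat]
    rw [← hf.summable_iff]
    · simp only [Function.comp_def, hf.extend_apply]
      exact hc.comp_injective Subtype.val_injective
    · intro n hn
      rw [Function.extend_apply' _ _ _ (fun ⟨x, hx⟩ => hn ⟨x, hx⟩)]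
      simp
  have h := continuous_sigmaWeak_tsum_inner_nat (⟨_, hext ha⟩ : lp (fun _ : ℕ => H) 2) ⟨_, hext hb⟩
  convert h using 2 with X
  have h1 : Function.support (fun n => ⟪Function.extend f (fun k : s => a k) 0 n,
      X (Function.extend f (fun k : s => b k) 0 n)⟫_ℂ) ⊆ Set.range f := by
    intro n hn
    by_contra hc
    refine hn ?_
    simp only
    rw [Function.extend_apply' _ _ _ (fun ⟨x, hx⟩ => hc ⟨x, hx⟩)]
    simp
  have h2 : Function.support (fun k => ⟪a k, X (b k)⟫_ℂ) ⊆ s := by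
    intro k hk
    by_contra hc
    refine hk ?_
    have : a k = 0 := by
      by_contra ha'
      exact hc (Or.inl (by simpa using ha'))
    simp [this]
  rw [← tsum_subtype_eq_of_support_subset h2]
  refine Eq.trans ?_ (hf.tsum_eq h1)
  simp only [hf.extend_apply]

end SigmaWeak

/-! ### / The normal completely positive map X ↦ W*(X ⊗ I)W / -/

section Conjugation

variable {ι H G : Type*} [NormedAddCommGroup H] [InnerProductSpace ℂ H]
  [NormedAddCommGroup G] [InnerProductSpace ℂ G] [CompleteSpace G] [CompleteSpace H]
  {V : ι → H →ₗᵢ[ℂ] G} (hV : IsHilbertSum ℂ (fun _ => H) V) (W : H →L[ℂ] G)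

/-- The linear map `X ↦ W* (X ⊗ I) W`. -/
def conjAmpₗ : (H →L[ℂ] H) →ₗ[ℂ] (H →L[ℂ] H) where
  toFun X := W.adjoint ∘L ampliation hV X ∘L W
  map_add' X Y := by
    rw [ampliation_add, ContinuousLinearMap.add_comp, ContinuousLinearMap.comp_add]
  map_smul' c X := by
    rw [ampliation_smul, ContinuousLinearMap.smul_comp, ContinuousLinearMap.comp_smul]
    rfl

theorem inner_conjAmpₗ (X : H →L[ℂ] H) (φ ψ : H) :
    ⟪φ, conjAmpₗ hV W X ψ⟫_ℂ = ⟪W φ, ampliation hV X (W ψ)⟫_ℂ :=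
  ContinuousLinearMap.adjoint_inner_right W φ _

theorem conjAmpₗ_star (X : H →L[ℂ] H) : conjAmpₗ hV W (star X) = star (conjAmpₗ hV W X) := by
  ext1 ψ
  refine ext_inner_left ℂ fun φ => ?_
  rw [inner_conjAmpₗ, inner_ampliation_star, ContinuousLinearMap.star_eq_adjoint,
    ContinuousLinearMap.adjoint_inner_right, ← inner_conj_symm (conjAmpₗ hV W X φ) ψ,
    inner_conjAmpₗ, inner_conj_symm]

theorem sum_sum_sum_comm {k : ℕ} (f : Fin k → Fin k → Fin k → ℂ) :
    ∑ i, ∑ j, ∑ l, f i j l = ∑ l, ∑ i, ∑ j, f i j l :=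
  (Finset.sum_congr rfl fun _ _ => Finset.sum_comm).trans Finset.sum_comm

/-- Positive matrices have the form N*N, and here the quadratic form of the image is a sum of
squared norms; this is the source of complete positivity. -/
theorem sum_inner_matrixAct_conjAmpₗ {k : ℕ} (N : CStarMatrix (Fin k) (Fin k) (H →L[ℂ] H))
    (x : Fin k → H) :
    ∑ i, ⟪x i, matrixAct ((star N * N).map (conjAmpₗ hV W)) x i⟫_ℂ =
      ∑ l, ⟪∑ i, ampliation hV (N l i) (W (x i)), ∑ i, ampliation hV (N l i) (W (x i))⟫_ℂ := by
  have h1 : ∀ i j, ⟪x i, conjAmpₗ hV W ((star N * N) i j) (x j)⟫_ℂ =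
      ∑ l, ⟪ampliation hV (N l i) (W (x i)), ampliation hV (N l j) (W (x j))⟫_ℂ := by
    intro i j
    rw [CStarMatrix.mul_apply, map_sum, sum_apply, inner_sum]
    refine Finset.sum_congr rfl fun l _ => ?_
    rw [inner_conjAmpₗ, ampliation_mul, CStarMatrix.star_apply, mul_apply_eq_comp,
      inner_ampliation_star]
  have h2 : ∀ l, ⟪∑ i, ampliation hV (N l i) (W (x i)),
      ∑ i, ampliation hV (N l i) (W (x i))⟫_ℂ =
      ∑ i, ∑ j, ⟪ampliation hV (N l i) (W (x i)), ampliation hV (N l j) (W (x j))⟫_ℂ := by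
    intro l
    rw [sum_inner]
    exact Finset.sum_congr rfl fun i _ => inner_sum _ _ _
  rw [Finset.sum_congr rfl fun l _ => h2 l, ← sum_sum_sum_comm]
  refine Finset.sum_congr rfl fun i _ => ?_
  rw [matrixAct, inner_sum]
  exact Finset.sum_congr rfl fun j _ => h1 i j

theorem conjAmpₗ_map_nonneg {k : ℕ} (M : CStarMatrix (Fin k) (Fin k) (H →L[ℂ] H)) (hM : 0 ≤ M) :
    0 ≤ M.map (conjAmpₗ hV W) := by
  refine cstarMatrix_nonneg _ ?_ fun x => ?_
  · have hsa := (IsSelfAdjoint.of_nonneg hM).star_eq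
    refine CStarMatrix.ext fun i j => ?_
    rw [CStarMatrix.star_apply, CStarMatrix.map_apply, CStarMatrix.map_apply, ← conjAmpₗ_star,
      ← CStarMatrix.star_apply, hsa]
  · obtain ⟨N, rfl⟩ := exists_eq_star_mul_self hM
    rw [sum_inner_matrixAct_conjAmpₗ, Complex.re_sum]
    exact Finset.sum_nonneg fun l _ => inner_self_nonneg (𝕜 := ℂ)

/-- The completely positive map `X ↦ W* (X ⊗ I) W`. -/
def conjAmp : (H →L[ℂ] H) →CP (H →L[ℂ] H) where
  toLinearMap := conjAmpₗ hV W
  map_cstarMatrix_nonneg' _ := conjAmpₗ_map_nonneg hV W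

theorem conjAmp_apply (X : H →L[ℂ] H) :
    conjAmp hV W X = W.adjoint ∘L ampliation hV X ∘L W := rfl

theorem inner_conjAmp (X : H →L[ℂ] H) (φ ψ : H) :
    ⟪φ, conjAmp hV W X ψ⟫_ℂ = ⟪W φ, ampliation hV X (W ψ)⟫_ℂ :=
  inner_conjAmpₗ hV W X φ ψ

theorem hasSum_norm_sq_adjoint (hV : IsHilbertSum ℂ (fun _ => H) V) (ξ : G) :
    HasSum (fun i => ‖(V i).toContinuousLinearMap.adjoint ξ‖ ^ 2) (‖ξ‖ ^ 2) := by
  have h := lp.hasSum_norm (p := 2) (by norm_num) (hV.linearIsometryEquiv ξ)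
  rw [LinearIsometryEquiv.norm_map] at h
  simp only [ENNReal.toReal_ofNat, Real.rpow_ofNat] at h
  refine h.congr_fun fun i => ?_
  rw [← hV.linearIsometryEquiv_apply_eq_adjoint]

theorem summable_prod_of_hasSum {κ ι : Type*} {g : κ × ι → ℝ} {b : κ → ℝ} (hg : ∀ p, 0 ≤ g p)
    (hs : ∀ n, HasSum (fun i => g (n, i)) (b n)) (hb : Summable b) : Summable g :=
  (summable_prod_of_nonneg hg).2 ⟨fun n => (hs n).summable, by simpa only [(hs _).tsum_eq] using hb⟩

theorem summable_norm_sq_adjoint (hV : IsHilbertSum ℂ (fun _ => H) V) {a : ℕ → G}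
    (ha : Summable fun n => ‖a n‖ ^ 2) :
    Summable fun p : ℕ × ι => ‖(V p.2).toContinuousLinearMap.adjoint (a p.1)‖ ^ 2 := by
  have hs : ∀ n, HasSum (fun i => ‖(V i).toContinuousLinearMap.adjoint (a n)‖ ^ 2) (‖a n‖ ^ 2) :=
    fun n => hasSum_norm_sq_adjoint hV (a n)
  have hg : ∀ p : ℕ × ι, 0 ≤ ‖(V p.2).toContinuousLinearMap.adjoint (a p.1)‖ ^ 2 :=
    fun _ => sq_nonneg _
  exact summable_prod_of_hasSum hg hs ha

/-- Expanding each W φ_n and W ψ_n in the Hilbert sum turns a weak* functional of the image into one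
of X, with square-summable families over pairs (n, i). -/
theorem continuous_conjAmp : Continuous[sigmaWeak H, sigmaWeak H] (conjAmp hV W) := by
  let _ := sigmaWeak H
  refine continuous_sigmaWeak_rng fun φ ψ => ?_
  have ha := summable_norm_sq_adjoint hV (summable_norm_sq_apply W φ)
  have hb := summable_norm_sq_adjoint hV (summable_norm_sq_apply W ψ)
  convert continuous_sigmaWeak_tsum_inner ha hb using 2 with X
  rw [(summable_inner_of_summable_sq ha hb X).tsum_prod]
  refine tsum_congr fun n => ?_
  rw [inner_conjAmp]
  exact (hasSum_inner_ampliation hV X _ _).tsum_eq.symm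

theorem conjAmp_one (hW : ∀ ψ, ‖W ψ‖ = ‖ψ‖) : conjAmp hV W 1 = 1 := by
  rw [conjAmp_apply, ampliation_one]
  exact (ContinuousLinearMap.norm_map_iff_adjoint_comp_self W).1 hW

end Conjugation

/-! ### / Fibers of elements of L²(μ ⊗ ν) / -/

section Fibers

variable {α β : Type*} [MeasurableSpace α] [MeasurableSpace β] {μ : Measure α} {ν : Measure β}

/-- The functions `f w ∈ L²(μ)` are the fibers `x ↦ F (x, w)` of `F ∈ L²(μ ⊗ ν)`. -/
def HasFibers (F : L2 (μ.prod ν)) (f : β → L2 μ) : Prop :=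
  ∀ᵐ w ∂ν, (fun x => F (x, w)) =ᵐ[μ] f w

variable {F G : L2 (μ.prod ν)} {f g : β → L2 μ}

theorem HasFibers.congr (hF : HasFibers F f) (h : ∀ᵐ w ∂ν, f w = g w) : HasFibers F g := by
  filter_upwards [hF, h] with w h1 h2
  rwa [← h2]

variable [SFinite μ] [SFinite ν]

theorem ae_ae_of_ae_prod_swap {p : α × β → Prop} (h : ∀ᵐ z ∂(μ.prod ν), p z) :
    ∀ᵐ w ∂ν, ∀ᵐ x ∂μ, p (x, w) :=
  Measure.ae_ae_of_ae_prod
    ((Measure.measurePreserving_swap (μ := ν) (ν := μ)).quasiMeasurePreserving.ae h)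

theorem hasFibers_tensor (ψ : L2 μ) (φ : L2 ν) : HasFibers (tensor ψ φ) fun w => φ w • ψ := by
  filter_upwards [ae_ae_of_ae_prod_swap (tensor_coeFn ψ φ)] with w hw
  filter_upwards [hw, Lp.coeFn_smul (φ w) ψ] with x h1 h2
  rw [h1, h2, Pi.smul_apply, smul_eq_mul, mul_comm]

theorem HasFibers.sub (hF : HasFibers F f) (hG : HasFibers G g) :
    HasFibers (F - G) fun w => f w - g w := by
  filter_upwards [hF, hG, ae_ae_of_ae_prod_swap (Lp.coeFn_sub F G)] with w h1 h2 h3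
  filter_upwards [h1, h2, h3, Lp.coeFn_sub (f w) (g w)] with x h4 h5 h6 h7
  rw [h6, h7, Pi.sub_apply, Pi.sub_apply, h4, h5]

theorem HasFibers.add (hF : HasFibers F f) (hG : HasFibers G g) :
    HasFibers (F + G) fun w => f w + g w := by
  filter_upwards [hF, hG, ae_ae_of_ae_prod_swap (Lp.coeFn_add F G)] with w h1 h2 h3
  filter_upwards [h1, h2, h3, Lp.coeFn_add (f w) (g w)] with x h4 h5 h6 h7
  rw [h6, h7, Pi.add_apply, Pi.add_apply, h4, h5]

theorem hasFibers_zero : HasFibers (0 : L2 (μ.prod ν)) fun _ => 0 := by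
  filter_upwards [ae_ae_of_ae_prod_swap (Lp.coeFn_zero ℂ 2 (μ.prod ν))] with w hw
  filter_upwards [hw, Lp.coeFn_zero ℂ 2 μ] with x h1 h2
  rw [h1, h2]
  rfl

theorem hasFibers_sum {ι : Type*} (s : Finset ι) {F : ι → L2 (μ.prod ν)} {f : ι → β → L2 μ}
    (h : ∀ i ∈ s, HasFibers (F i) (f i)) : HasFibers (∑ i ∈ s, F i) fun w => ∑ i ∈ s, f i w := by
  classical
  induction s using Finset.induction_on with
  | empty => simpa using hasFibers_zero
  | insert a s ha ih =>
    simp only [Finset.sum_insert ha]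
    exact (h a (by simp)).add (ih fun i hi => h i (by simp [hi]))

/-- This is Fubini for the integrable function ⟪F, G⟫; no measurability of w ↦ f w as an L²-valued
map is needed. -/
theorem HasFibers.inner (hF : HasFibers F f) (hG : HasFibers G g) :
    ⟪F, G⟫_ℂ = ∫ w, ⟪f w, g w⟫_ℂ ∂ν := by
  rw [L2.inner_def, integral_prod_symm _ (L2.integrable_inner F G)]
  refine integral_congr_ae ?_
  filter_upwards [hF, hG] with w h1 h2
  rw [L2.inner_def]
  refine integral_congr_ae ?_
  filter_upwards [h1, h2] with x h3 h4
  rw [h3, h4]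

theorem HasFibers.norm_sq (hF : HasFibers F f) : ‖F‖ ^ 2 = ∫ w, ‖f w‖ ^ 2 ∂ν := by
  have h := hF.inner hF
  simp only [inner_self_eq_norm_sq_to_K] at h
  have h2 : ((‖F‖ ^ 2 : ℝ) : ℂ) = ((∫ w, ‖f w‖ ^ 2 ∂ν : ℝ) : ℂ) := by
    rw [← integral_complex_ofReal]
    simpa using h
  exact_mod_cast h2

theorem HasFibers.unique (hF : HasFibers F f) (hG : HasFibers G f) : F = G := by
  have h := (hF.sub hG).norm_sq
  simp only [sub_self, norm_zero, ne_eq, OfNat.ofNat_ne_zero, not_false_eq_true, zero_pow,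
    integral_zero] at h
  exact sub_eq_zero.1 (norm_eq_zero.1 (pow_eq_zero_iff two_ne_zero |>.1 h))

end Fibers

/-! ### / Random translations and the ampliation / -/

section Translation

variable {d : ℕ}

/-- The translation `ψ ↦ ψ (· + a)` of `L²(ℝ^d)`. -/
def translate (a : E d) : L2 (volume : Measure (E d)) →ₗᵢ[ℂ] L2 (volume : Measure (E d)) :=
  Lp.compMeasurePreservingₗᵢ ℂ (fun x => x + a) (measurePreserving_add_right volume a)

theorem translate_coeFn (a : E d) (ψ : L2 (volume : Measure (E d))) :
    translate a ψ =ᵐ[volume] fun x => ψ (x + a) :=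
  Lp.coeFn_compMeasurePreserving ψ (measurePreserving_add_right volume a)

theorem continuous_translate (ψ : L2 (volume : Measure (E d))) :
    Continuous fun a => translate a ψ := by
  let f : E d → C(E d, E d) := (ContinuousMap.mk (fun p : E d × E d => p.2 + p.1)
    (by fun_prop)).curry
  have hf : Continuous f := ContinuousMap.continuous _
  exact (continuous_const (y := ψ)).compMeasurePreservingLp hf
    (fun a => measurePreserving_add_right volume a) (by norm_num)

theorem translate_add (a b : E d) (ψ : L2 (volume : Measure (E d))) :
    translate (a + b) ψ = translate b (translate a ψ) := by
  refine Lp.ext ?_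
  filter_upwards [translate_coeFn (a + b) ψ, translate_coeFn b (translate a ψ),
    (measurePreserving_add_right volume b).quasiMeasurePreserving.ae (translate_coeFn a ψ)]
    with x h1 h2 h3
  rw [h1, h2, h3, add_assoc, add_comm b a]

theorem translate_zero (ψ : L2 (volume : Measure (E d))) : translate 0 ψ = ψ := by
  refine Lp.ext ?_
  filter_upwards [translate_coeFn 0 ψ] with x h1
  rw [h1, add_zero]

variable {β : Type*} [MeasurableSpace β] (ν : Measure β) [IsProbabilityMeasure ν]

theorem measurePreserving_add_comp {g : β → E d} (hg : Measurable g) :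
    MeasurePreserving (fun z : E d × β => z.1 + g z.2) (volume.prod ν) volume := by
  have h : MeasurePreserving (fun p : β × E d => (p.1, p.2 + g p.1))
      (ν.prod volume) (ν.prod volume) :=
    (MeasurePreserving.id ν).skew_product (g := fun w x => x + g w)
      (measurable_snd.add (hg.comp measurable_fst))
      (Eventually.of_forall fun w => (measurePreserving_add_right volume (g w)).map_eq)
  exact measurePreserving_snd.comp
    (h.comp (Measure.measurePreserving_swap (μ := volume) (ν := ν)))

/-- The isometry that sends `ψ` to `(x, w) ↦ ψ (x + g w)`. -/
def spread {g : β → E d} (hg : Measurable g) :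
    L2 (volume : Measure (E d)) →ₗᵢ[ℂ] L2 ((volume : Measure (E d)).prod ν) :=
  Lp.compMeasurePreservingₗᵢ ℂ _ (measurePreserving_add_comp ν hg)

theorem spread_coeFn {g : β → E d} (hg : Measurable g) (ψ : L2 (volume : Measure (E d))) :
    spread ν hg ψ =ᵐ[volume.prod ν] fun z => ψ (z.1 + g z.2) :=
  Lp.coeFn_compMeasurePreserving ψ (measurePreserving_add_comp ν hg)

theorem hasFibers_spread {g : β → E d} (hg : Measurable g) (ψ : L2 (volume : Measure (E d))) :
    HasFibers (spread ν hg ψ) fun w => translate (g w) ψ := by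
  filter_upwards [ae_ae_of_ae_prod_swap (spread_coeFn ν hg ψ)] with w hw
  filter_upwards [hw, translate_coeFn (g w) ψ] with x h1 h2
  rw [h1, h2]

variable {ν}

/-- A simple function with values in `L²(μ)`, as a combination of elementary tensors. -/
theorem hasFibers_sum_tensor (g : SimpleFunc β (E d))
    (c : E d → L2 (volume : Measure (E d))) :
    HasFibers (∑ a ∈ g.range, tensor (c a)
      (indicatorConstLp 2 (g.measurableSet_fiber a) (measure_ne_top ν _) (1 : ℂ)))
      fun w => c (g w) := by
  refine (hasFibers_sum _ fun a _ => hasFibers_tensor _ _).congr ?_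
  have h : ∀ a ∈ g.range, ∀ᵐ w ∂ν,
      (indicatorConstLp 2 (g.measurableSet_fiber a) (measure_ne_top ν _) (1 : ℂ)) w =
        (g ⁻¹' {a}).indicator (fun _ => (1 : ℂ)) w := fun a _ => indicatorConstLp_coeFn
  filter_upwards [(Finset.eventually_all g.range).2 h] with w hw
  rw [Finset.sum_congr rfl fun a ha => by rw [hw a ha], Finset.sum_eq_single (g w)]
  · simp
  · intro b _ hb
    simp [Set.indicator, hb.symm]
  · intro hn
    exact absurd (g.mem_range_self w) hn

variable {ι : Type*} (e : HilbertBasis ι ℂ (L2 ν))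

/-- For simple g the spread vector is a finite sum of elementary tensors, on which the ampliation is
explicit. -/
theorem inner_ampliation_spread_simpleFunc
    (X : L2 (volume : Measure (E d)) →L[ℂ] L2 (volume : Measure (E d))) (g : SimpleFunc β (E d))
    (φ ψ : L2 (volume : Measure (E d))) :
    ⟪spread ν g.measurable φ, ampliation (isHilbertSum_tensor e) X (spread ν g.measurable ψ)⟫_ℂ =
      ∫ w, ⟪translate (g w) φ, X (translate (g w) ψ)⟫_ℂ ∂ν := by
  have h1 := (hasFibers_spread ν g.measurable ψ).unique
    (hasFibers_sum_tensor g fun a => translate a ψ)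
  refine (hasFibers_spread ν g.measurable φ).inner ?_
  rw [h1, map_sum]
  simp only [ampliation_tensor]
  exact hasFibers_sum_tensor g fun a => X (translate a ψ)

theorem tendsto_spread {g : β → E d} (hg : Measurable g) {u : ℕ → SimpleFunc β (E d)}
    (hu : ∀ w, Tendsto (fun n => u n w) atTop (𝓝 (g w))) (ψ : L2 (volume : Measure (E d))) :
    Tendsto (fun n => spread ν (u n).measurable ψ) atTop (𝓝 (spread ν hg ψ)) := by
  rw [tendsto_iff_norm_sub_tendsto_zero]
  have h : Tendsto (fun n => ∫ w, ‖translate (u n w) ψ - translate (g w) ψ‖ ^ 2 ∂ν) atTop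
      (𝓝 (∫ _, (0 : ℝ) ∂ν)) := by
    refine tendsto_integral_of_dominated_convergence (fun _ => (‖ψ‖ + ‖ψ‖) ^ 2) (fun n => ?_)
      (integrable_const _) (fun n => Eventually.of_forall fun w => ?_)
      (Eventually.of_forall fun w => ?_)
    · exact ((((continuous_translate ψ).comp_stronglyMeasurable (u n).stronglyMeasurable).sub
        ((continuous_translate ψ).comp_stronglyMeasurable hg.stronglyMeasurable)).norm.pow
          2).aestronglyMeasurable
    · rw [Real.norm_of_nonneg (sq_nonneg _)]
      refine pow_le_pow_left₀ (norm_nonneg _) ((norm_sub_le _ _).trans ?_) 2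
      rw [LinearIsometry.norm_map, LinearIsometry.norm_map]
    · have h1 := ((continuous_translate ψ).tendsto (g w)).comp (hu w)
      have h2 := ((h1.sub_const (translate (g w) ψ)).norm).pow 2
      simpa using h2
  rw [integral_zero] at h
  simp only [← ((hasFibers_spread ν (u _).measurable ψ).sub (hasFibers_spread ν hg ψ)).norm_sq] at h
  have h3 := h.sqrt
  simpa [Real.sqrt_sq (norm_nonneg _)] using h3

theorem continuous_inner_translate
    (X : L2 (volume : Measure (E d)) →L[ℂ] L2 (volume : Measure (E d)))
    (φ ψ : L2 (volume : Measure (E d))) :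
    Continuous fun a => ⟪translate a φ, X (translate a ψ)⟫_ℂ :=
  (continuous_translate φ).inner (X.continuous.comp (continuous_translate ψ))

theorem norm_inner_translate_le
    (X : L2 (volume : Measure (E d)) →L[ℂ] L2 (volume : Measure (E d)))
    (φ ψ : L2 (volume : Measure (E d))) (a : E d) :
    ‖⟪translate a φ, X (translate a ψ)⟫_ℂ‖ ≤ ‖φ‖ * (‖X‖ * ‖ψ‖) := by
  refine (norm_inner_le_norm _ _).trans ?_
  rw [LinearIsometry.norm_map]
  gcongr
  simpa using X.le_opNorm (translate a ψ)

/-- Both sides pass to the limit along simple approximations of g: the left by L² convergence of the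
spread vectors, the right by strong continuity of translations and dominated convergence. -/
theorem inner_ampliation_spread
    (X : L2 (volume : Measure (E d)) →L[ℂ] L2 (volume : Measure (E d))) {g : β → E d}
    (hg : Measurable g) (φ ψ : L2 (volume : Measure (E d))) :
    ⟪spread ν hg φ, ampliation (isHilbertSum_tensor e) X (spread ν hg ψ)⟫_ℂ =
      ∫ w, ⟪translate (g w) φ, X (translate (g w) ψ)⟫_ℂ ∂ν := by
  let u := hg.stronglyMeasurable.approx
  have hu : ∀ w, Tendsto (fun n => u n w) atTop (𝓝 (g w)) := hg.stronglyMeasurable.tendsto_approx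
  have h1 : Tendsto (fun n => ⟪spread ν (u n).measurable φ,
      ampliation (isHilbertSum_tensor e) X (spread ν (u n).measurable ψ)⟫_ℂ) atTop
      (𝓝 ⟪spread ν hg φ, ampliation (isHilbertSum_tensor e) X (spread ν hg ψ)⟫_ℂ) :=
    (tendsto_spread hg hu φ).inner
      (((ampliation (isHilbertSum_tensor e) X).continuous.tendsto _).comp (tendsto_spread hg hu ψ))
  simp only [inner_ampliation_spread_simpleFunc] at h1
  refine tendsto_nhds_unique h1 ?_
  refine tendsto_integral_of_dominated_convergence (fun _ => ‖φ‖ * (‖X‖ * ‖ψ‖)) (fun n => ?_)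
    (integrable_const _) (fun n => Eventually.of_forall fun w => norm_inner_translate_le X φ ψ _)
    (Eventually.of_forall fun w => ?_)
  · exact ((continuous_inner_translate X φ ψ).comp_stronglyMeasurable
      (u n).stronglyMeasurable).aestronglyMeasurable
  · exact ((continuous_inner_translate X φ ψ).tendsto _).comp (hu w)

end Translation

/-! ### / The quantum extension as an average over translations / -/

theorem ae_norm_le_norm {α : Type*} [MeasurableSpace α] {μ : Measure α} (f : LInf μ) :
    ∀ᵐ x ∂μ, ‖f x‖ ≤ ‖f‖ := by
  filter_upwards [ae_le_eLpNormEssSup (f := f) (μ := μ)] with x hx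
  rw [Lp.norm_def, ← toReal_enorm, eLpNorm_exponent_top]
  exact ENNReal.toReal_mono (eLpNorm_exponent_top (f := f) (μ := μ) ▸ Lp.eLpNorm_ne_top f) hx

namespace IncrementProcess

variable {d : ℕ} {Ω : Type*} [MeasurableSpace Ω] (S : IncrementProcess d Ω)

theorem integral_X {F : Type*} [NormedAddCommGroup F] [NormedSpace ℝ F] (x : E d) (t : ℝ≥0)
    {f : E d → F} (hf : StronglyMeasurable f) :
    ∫ ω, f (S.X t ω) ∂S.law x = ∫ y, f (x + y) ∂S.incrLaw t := by
  rw [← integral_map (S.measurable t).aemeasurable hf.aestronglyMeasurable, map_X,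
    integral_map (measurable_const_add x).aemeasurable hf.aestronglyMeasurable]

theorem integral_shift {F : Type*} [NormedAddCommGroup F] [NormedSpace ℝ F] (x : E d) (t : ℝ≥0)
    {f : E d → F} (hf : StronglyMeasurable f) :
    ∫ w, f (shift (t : ℝ) (x, w)).1 ∂S.twoSidedLaw = ∫ y, f (x + y) ∂S.incrLaw t := by
  rw [← S.map_coord, integral_map (measurable_coord _).aemeasurable
    (f := fun y => f (x + y)) (hf.comp_measurable (measurable_const_add x)).aestronglyMeasurable]
  rfl

variable {ι : Type*} (e : HilbertBasis ι ℂ (L2 S.twoSidedLaw))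

/-- The quantum extension of the transition semigroup at time `t`. -/
def quantumExt (t : ℝ≥0) :
    (L2 (volume : Measure (E d)) →L[ℂ] L2 (volume : Measure (E d))) →CP
      (L2 (volume : Measure (E d)) →L[ℂ] L2 (volume : Measure (E d))) :=
  conjAmp (isHilbertSum_tensor e)
    (spread S.twoSidedLaw (measurable_backIncr t)).toContinuousLinearMap

variable (X : L2 (volume : Measure (E d)) →L[ℂ] L2 (volume : Measure (E d)))
  (φ ψ : L2 (volume : Measure (E d)))

theorem inner_quantumExt (t : ℝ≥0) :
    ⟪φ, S.quantumExt e t X ψ⟫_ℂ =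
      ∫ y, ⟪translate y φ, X (translate y ψ)⟫_ℂ ∂S.backLaw t := by
  rw [quantumExt, inner_conjAmp, ← S.map_backIncr,
    integral_map (measurable_backIncr t).aemeasurable
      (continuous_inner_translate X φ ψ).aestronglyMeasurable]
  exact inner_ampliation_spread e X (measurable_backIncr t) φ ψ

theorem integrable_inner_translate (ρ : Measure (E d)) [IsFiniteMeasure ρ] :
    Integrable (fun y => ⟪translate y φ, X (translate y ψ)⟫_ℂ) ρ :=
  .of_bound (continuous_inner_translate X φ ψ).aestronglyMeasurable (‖φ‖ * (‖X‖ * ‖ψ‖))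
    (Eventually.of_forall (norm_inner_translate_le X φ ψ))

theorem norm_inner_quantumExt_le (t : ℝ≥0) :
    ‖⟪φ, S.quantumExt e t X ψ⟫_ℂ‖ ≤ ‖φ‖ * (‖X‖ * ‖ψ‖) := by
  rw [inner_quantumExt]
  refine (norm_integral_le_of_norm_le_const (Eventually.of_forall
    (norm_inner_translate_le X φ ψ))).trans ?_
  simp

theorem norm_quantumExt_le (t : ℝ≥0) : ‖S.quantumExt e t X‖ ≤ ‖X‖ := by
  refine ContinuousLinearMap.opNorm_le_bound _ (norm_nonneg _) fun ψ => ?_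
  -- Testing against the image vector itself bounds its squared norm; one factor is then cancelled.
  have h := S.norm_inner_quantumExt_le e X (S.quantumExt e t X ψ) ψ t
  rw [inner_self_eq_norm_sq_to_K, norm_pow, RCLike.norm_ofReal, abs_norm, sq] at h
  by_cases h0 : ‖S.quantumExt e t X ψ‖ = 0
  · rw [h0]; positivity
  · exact le_of_mul_le_mul_left h (lt_of_le_of_ne (norm_nonneg _) (Ne.symm h0))

theorem quantumExt_zero : S.quantumExt e 0 X = X := by
  ext1 ψ
  refine ext_inner_left ℂ fun φ => ?_
  rw [inner_quantumExt, backLaw_zero, integral_dirac, translate_zero, translate_zero]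

/-- The average over λ_s * λ_t is an iterated average, and translations compose. -/
theorem quantumExt_add (s t : ℝ≥0) :
    S.quantumExt e (s + t) X = S.quantumExt e s (S.quantumExt e t X) := by
  ext1 ψ
  refine ext_inner_left ℂ fun φ => ?_
  rw [inner_quantumExt, inner_quantumExt, backLaw_add, integral_conv]
  · simp only [inner_quantumExt, translate_add]
  · exact integrable_inner_translate X φ ψ _

theorem isCPSemigroup_quantumExt : IsCPSemigroup (S.quantumExt e) where
  normal _ := continuous_conjAmp _ _
  map_one _ := conjAmp_one _ _ (LinearIsometry.norm_map _)
  zero := S.quantumExt_zero e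
  add s t X := S.quantumExt_add e X s t

theorem inner_translate_mulOp (f : LInf (volume : Measure (E d))) (y : E d) :
    ⟪translate y φ, mulOp f (translate y ψ)⟫_ℂ = ∫ x, f (x + -y) * ⟪φ x, ψ x⟫_ℂ := by
  rw [L2.inner_def, ← integral_add_right_eq_self (fun x => f (x + -y) * ⟪φ x, ψ x⟫_ℂ) y]
  refine integral_congr_ae ?_
  filter_upwards [translate_coeFn y φ, translate_coeFn y ψ, mulOp_coeFn f (translate y ψ)]
    with x h1 h2 h3
  rw [h3, h1, h2, add_neg_cancel_right]
  simp only [RCLike.inner_apply]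
  ring

/-- Conjugating M_f by the translation by y gives multiplication by f(· - y). Fubini moves the
average under λ_t onto f, and reflecting y turns it into the transition formula for P_t f. -/
theorem quantumExt_mulOp
    {P : ℝ≥0 → (LInf (volume : Measure (E d)) →L[ℂ] LInf (volume : Measure (E d)))}
    (hP : S.IsTransitionSemigroup P) (t : ℝ≥0) (f : LInf (volume : Measure (E d))) :
    S.quantumExt e t (mulOp f) = mulOp (P t f) := by
  ext1 ψ
  refine ext_inner_left ℂ fun φ => ?_
  have hf : StronglyMeasurable f := Lp.stronglyMeasurable f
  rw [inner_quantumExt]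
  simp only [inner_translate_mulOp]
  have hint : Integrable (fun z : E d × E d => f (z.1 + -z.2) * ⟪φ z.1, ψ z.1⟫_ℂ)
      (volume.prod (S.backLaw t)) := by
    have h1 : Integrable (fun z : E d × E d => ⟪φ z.1, ψ z.1⟫_ℂ) (volume.prod (S.backLaw t)) :=
      Integrable.comp_fst (f := fun x => ⟪φ x, ψ x⟫_ℂ) (L2.integrable_inner φ ψ) _
    -- The essential bound on f holds only almost everywhere; it pulls back along (x, y) ↦ x - y
    -- because this map sends the product measure to Lebesgue measure.
    have hmp := measurePreserving_add_comp (S.backLaw t) (measurable_neg (G := E d))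
    refine h1.bdd_mul (c := ‖f‖) (hf.comp_measurable hmp.measurable).aestronglyMeasurable ?_
    exact hmp.quasiMeasurePreserving.ae (ae_norm_le_norm f)
  rw [integral_integral_swap (f := fun y x => f (x + -y) * ⟪φ x, ψ x⟫_ℂ) hint.swap, L2.inner_def]
  refine integral_congr_ae ?_
  filter_upwards [mulOp_coeFn (P t f) ψ, hP t f] with x h1 h2
  rw [h1, h2, S.integral_X x t hf, integral_mul_const, integral_incrLaw_eq_backLaw]
  simp only [RCLike.inner_apply]
  ring

/-! ### / Weak* continuity under condition (B) / -/

theorem lintegral_displacement (t : ℝ≥0) :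
    ∫⁻ ω, ‖ψ (S.X t ω) - ψ (S.X 0 ω)‖ₑ ^ 2 ∂S.lawLebesgue =
      ∫⁻ y, ‖translate y ψ - ψ‖ₑ ^ 2 ∂S.incrLaw t := by
  have hψ : Measurable ψ := (Lp.stronglyMeasurable ψ).measurable
  have hm : Measurable fun ω => ‖ψ (S.X t ω) - ψ (S.X 0 ω)‖ₑ ^ 2 :=
    (((hψ.comp (S.measurable t)).sub (hψ.comp (S.measurable 0))).enorm).pow_const 2
  have h1 : ∀ x, ∫⁻ ω, ‖ψ (S.X t ω) - ψ (S.X 0 ω)‖ₑ ^ 2 ∂S.law x =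
      ∫⁻ y, ‖ψ (x + y) - ψ x‖ₑ ^ 2 ∂S.incrLaw t := by
    intro x
    have h2 : (fun ω => ‖ψ (S.X t ω) - ψ (S.X 0 ω)‖ₑ ^ 2) =ᵐ[S.law x]
        fun ω => ‖ψ (S.X t ω) - ψ x‖ₑ ^ 2 := by
      filter_upwards [S.start x] with ω hω
      rw [hω]
    have hm2 : Measurable fun y => ‖ψ y - ψ x‖ₑ ^ 2 := ((hψ.sub_const _).enorm).pow_const 2
    rw [lintegral_congr_ae h2, ← lintegral_map hm2 (S.measurable t), map_X,
      lintegral_map hm2 (measurable_const_add x)]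
  have h3 : ∀ y, ∫⁻ x, ‖ψ (x + y) - ψ x‖ₑ ^ 2 = ‖translate y ψ - ψ‖ₑ ^ 2 := by
    intro y
    have h4 := eLpNorm_nnreal_pow_eq_lintegral (μ := (volume : Measure (E d))) (p := 2)
      (f := (translate y ψ - ψ : L2 (volume : Measure (E d)))) (by norm_num)
    simp only [NNReal.coe_ofNat, ENNReal.rpow_ofNat, ENNReal.coe_ofNat] at h4
    rw [Lp.enorm_def, h4]
    refine lintegral_congr_ae ?_
    filter_upwards [translate_coeFn y ψ, Lp.coeFn_sub (translate y ψ) ψ] with x h5 h6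
    rw [h6, Pi.sub_apply, h5]
  rw [lawLebesgue, Measure.lintegral_bind S.law.measurable.aemeasurable hm.aemeasurable]
  simp only [h1]
  rw [lintegral_lintegral_swap]
  · simp only [h3]
  · exact ((((hψ.comp (measurable_fst.add measurable_snd)).sub
      (hψ.comp measurable_fst)).enorm).pow_const 2).aemeasurable

/-- The mean displacement of `ψ` under the translations at time `t`. -/
def displacement (t : ℝ≥0) : ℝ := ∫ y, ‖translate y ψ - ψ‖ ∂S.backLaw t

theorem memLp_translate_sub (ρ : Measure (E d)) [IsFiniteMeasure ρ] (p : ℝ≥0∞) :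
    MemLp (fun y => ‖translate y ψ - ψ‖) p ρ :=
  .of_bound ((continuous_translate ψ).sub continuous_const).norm.aestronglyMeasurable
    (‖ψ‖ + ‖ψ‖) (Eventually.of_forall fun y => by
      rw [norm_norm]
      refine (norm_sub_le _ _).trans ?_
      rw [LinearIsometry.norm_map])

/-- By this symmetry the displacement is the same for the increment law and its reflection. -/
theorem norm_translate_neg_sub (y : E d) : ‖translate (-y) ψ - ψ‖ = ‖translate y ψ - ψ‖ := by
  rw [← (translate y).norm_map (translate (-y) ψ - ψ), map_sub, ← translate_add, neg_add_cancel,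
    translate_zero, norm_sub_rev]

theorem displacement_sq_le (t : ℝ≥0) :
    ENNReal.ofReal (S.displacement ψ t ^ 2) ≤
      ∫⁻ ω, ‖ψ (S.X t ω) - ψ (S.X 0 ω)‖ₑ ^ 2 ∂S.lawLebesgue := by
  have hL := memLp_translate_sub ψ (S.backLaw t) 2
  have h1 : S.displacement ψ t ^ 2 ≤ ∫ y, ‖translate y ψ - ψ‖ ^ 2 ∂S.backLaw t := by
    -- Jensen's inequality for the square, as nonnegativity of the variance.
    have h2 := variance_nonneg (fun y => ‖translate y ψ - ψ‖) (S.backLaw t)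
    rw [variance_eq_sub hL] at h2
    exact sub_nonneg.1 h2
  rw [S.lintegral_displacement, lintegral_incrLaw_eq_backLaw]
  refine (ENNReal.ofReal_le_ofReal h1).trans ?_
  rw [ofReal_integral_eq_lintegral_ofReal hL.integrable_sq
    (Eventually.of_forall fun _ => sq_nonneg _)]
  refine (lintegral_congr fun y => ?_).le
  rw [← ofReal_norm, norm_translate_neg_sub, ENNReal.ofReal_pow (norm_nonneg _)]

theorem tendsto_displacement (hS : S.ContinuityCondition) :
    Tendsto (S.displacement ψ) (𝓝 0) (𝓝 0) := by
  have h1 : Tendsto (fun t => ENNReal.ofReal (S.displacement ψ t ^ 2)) (𝓝 0) (𝓝 0) :=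
    tendsto_of_tendsto_of_tendsto_of_le_of_le tendsto_const_nhds (hS ψ) (fun _ => zero_le)
      (S.displacement_sq_le ψ)
  have h2 := ((ENNReal.tendsto_toReal ENNReal.zero_ne_top).comp h1).sqrt
  simp only [ENNReal.toReal_zero, Real.sqrt_zero] at h2
  refine h2.congr fun t => ?_
  simp only [Function.comp]
  rw [ENNReal.toReal_ofReal (sq_nonneg _), Real.sqrt_sq]
  exact integral_nonneg fun _ => norm_nonneg _

theorem norm_inner_quantumExt_sub_le (t : ℝ≥0) :
    ‖⟪φ, S.quantumExt e t X ψ⟫_ℂ - ⟪φ, X ψ⟫_ℂ‖ ≤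
      ‖X‖ * (‖ψ‖ * S.displacement φ t + ‖φ‖ * S.displacement ψ t) := by
  have hi := fun ψ => (memLp_translate_sub ψ (S.backLaw t) 1).integrable le_rfl
  have h0 : ⟪φ, X ψ⟫_ℂ = ∫ _, ⟪φ, X ψ⟫_ℂ ∂S.backLaw t := by simp
  rw [inner_quantumExt, h0, ← integral_sub (integrable_inner_translate X φ ψ _)
    (integrable_const _), displacement, displacement, ← integral_const_mul, ← integral_const_mul,
    ← integral_add ((hi φ).const_mul _) ((hi ψ).const_mul _), ← integral_const_mul]
  refine norm_integral_le_of_norm_le ((((hi φ).const_mul _).add ((hi ψ).const_mul _)).const_mul _)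
    (Eventually.of_forall fun y => ?_)
  have h1 : ⟪translate y φ, X (translate y ψ)⟫_ℂ - ⟪φ, X ψ⟫_ℂ =
      ⟪translate y φ - φ, X (translate y ψ)⟫_ℂ + ⟪φ, X (translate y ψ - ψ)⟫_ℂ := by
    rw [inner_sub_left, map_sub, inner_sub_right]
    ring
  have h2 : ‖⟪translate y φ - φ, X (translate y ψ)⟫_ℂ‖ ≤
      ‖translate y φ - φ‖ * (‖X‖ * ‖ψ‖) := by
    refine (norm_inner_le_norm _ _).trans ?_
    gcongr
    simpa using X.le_opNorm (translate y ψ)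
  have h3 : ‖⟪φ, X (translate y ψ - ψ)⟫_ℂ‖ ≤ ‖φ‖ * (‖X‖ * ‖translate y ψ - ψ‖) := by
    refine (norm_inner_le_norm _ _).trans ?_
    gcongr
    exact X.le_opNorm _
  rw [h1]
  refine (norm_add_le _ _).trans ((add_le_add h2 h3).trans (le_of_eq ?_))
  ring

end IncrementProcess

/-- Since δ does not depend on the base time, a bound on forward increments also controls times
approaching from the left. -/
theorem continuous_of_norm_add_sub_le {F : Type*} [SeminormedAddCommGroup F] {f : ℝ≥0 → F}
    {δ : ℝ≥0 → ℝ} (hδ : Tendsto δ (𝓝 0) (𝓝 0)) (h : ∀ t r, ‖f (t + r) - f t‖ ≤ δ r) :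
    Continuous f := by
  have h1 : ∀ s t, ‖f s - f t‖ ≤ δ (nndist s t) := by
    intro s t
    wlog hst : t ≤ s generalizing s t
    · rw [norm_sub_rev, nndist_comm]
      exact this t s (le_of_not_ge hst)
    · have h2 : nndist s t = s - t := by
        rw [← NNReal.coe_inj, coe_nndist, NNReal.dist_eq, NNReal.coe_sub hst,
          abs_of_nonneg (sub_nonneg.2 (NNReal.coe_le_coe.2 hst))]
      have h3 := h t (s - t)
      rwa [add_tsub_cancel_of_le hst, ← h2] at h3
  refine continuous_iff_continuousAt.2 fun t => ?_
  rw [ContinuousAt, tendsto_iff_norm_sub_tendsto_zero]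
  have h4 : Tendsto (fun s => nndist s t) (𝓝 t) (𝓝 0) := by
    have : Continuous fun s => nndist s t := by fun_prop
    simpa using this.tendsto t
  exact squeeze_zero (fun _ => norm_nonneg _) (fun s => h1 s t) (hδ.comp h4)

namespace IncrementProcess

variable {d : ℕ} {Ω : Type*} [MeasurableSpace Ω] (S : IncrementProcess d Ω)
  {ι : Type*} (e : HilbertBasis ι ℂ (L2 S.twoSidedLaw))

theorem continuous_inner_quantumExt (hS : S.ContinuityCondition)
    (X : L2 (volume : Measure (E d)) →L[ℂ] L2 (volume : Measure (E d)))
    (φ ψ : L2 (volume : Measure (E d))) :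
    Continuous fun t => ⟪φ, S.quantumExt e t X ψ⟫_ℂ := by
  refine continuous_of_norm_add_sub_le
    (δ := fun r => ‖X‖ * (‖ψ‖ * S.displacement φ r + ‖φ‖ * S.displacement ψ r)) ?_ fun t r => ?_
  · simpa using (((S.tendsto_displacement φ hS).const_mul ‖ψ‖).add
      ((S.tendsto_displacement ψ hS).const_mul ‖φ‖)).const_mul ‖X‖
  -- The short time r acts last, so the estimate at 0 applies to the operator 𝒫_t(X), whose norm is
  -- at most ‖X‖.
  · rw [add_comm t r, quantumExt_add]
    refine (S.norm_inner_quantumExt_sub_le e _ φ ψ r).trans ?_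
    have h : ∀ ψ, 0 ≤ S.displacement ψ r := fun ψ => integral_nonneg fun _ => norm_nonneg _
    have := h φ
    have := h ψ
    gcongr
    exact S.norm_quantumExt_le e X t

theorem isQuantumMarkovSemigroup_quantumExt (hS : S.ContinuityCondition) :
    IsQuantumMarkovSemigroup (S.quantumExt e) where
  toIsCPSemigroup := S.isCPSemigroup_quantumExt e
  continuous X := by
    refine continuous_sigmaWeak_rng fun φ ψ => ?_
    -- The Weierstrass test, with a summable bound that is uniform in t.
    refine continuous_tsum (u := fun n => ‖X‖ * (‖φ n‖ ^ 2 + ‖ψ n‖ ^ 2))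
      (fun n => S.continuous_inner_quantumExt e hS X _ _)
      (((summable_norm_sq φ).add (summable_norm_sq ψ)).mul_left _) fun n t => ?_
    refine (S.norm_inner_quantumExt_le e X _ _ t).trans ?_
    rw [mul_left_comm]
    gcongr
    nlinarith [sq_nonneg (‖φ n‖ - ‖ψ n‖), sq_nonneg ‖φ n‖, sq_nonneg ‖ψ n‖]

end IncrementProcess

/-! ### / The cocycle / -/

theorem IsUnitaryGroup.star_eq {H : Type*} [NormedAddCommGroup H] [InnerProductSpace ℂ H]
    [CompleteSpace H] {U : ℝ → unitary (H →L[ℂ] H)} (hU : IsUnitaryGroup U) (t : ℝ) :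
    star (U t) = U (-t) := by
  refine left_inv_eq_right_inv (Unitary.star_mul_self (U t)) ?_
  rw [← hU.add, add_neg_cancel, hU.zero]

theorem IsUnitaryGroup.cocycle {H : Type*} [NormedAddCommGroup H] [InnerProductSpace ℂ H]
    [CompleteSpace H] {U Θ : ℝ → unitary (H →L[ℂ] H)} (hU : IsUnitaryGroup U)
    (hΘ : IsUnitaryGroup Θ) (s t : ℝ) :
    star (Θ (s + t)) * U (s + t) =
      star (Θ s) * (star (Θ t) * U t) * Θ s * (star (Θ s) * U s) := by
  have h1 : Θ s * (star (Θ s) * U s) = U s := by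
    rw [← mul_assoc, Unitary.mul_star_self, one_mul]
  rw [mul_assoc _ (Θ s), h1, add_comm s t, hU.add, hΘ.add, star_mul]
  simp only [mul_assoc]

/-- The point (x, w) goes to (x, η_{-t} w) and then under θ_{-t} to a point with first coordinate x
+ w_{-2t} - w_{-t}; the factor 1 ignores the path. -/
theorem IncrementProcess.star_comp_tensor_oneVec {d : ℕ} {Ω : Type*} [MeasurableSpace Ω]
    (S : IncrementProcess d Ω) {U Θ : ℝ → unitary (L2 S.totalMeasure →L[ℂ] L2 S.totalMeasure)}
    (hΘ : IsUnitaryGroup Θ)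
    (hUc : ∀ t, IsComposition (U t : L2 S.totalMeasure →L[ℂ] L2 S.totalMeasure) (shift (-t)))
    (hΘc : ∀ t, IsComposition (Θ t : L2 S.totalMeasure →L[ℂ] L2 S.totalMeasure)
      (Prod.map id (pathShift t))) (t : ℝ≥0) :
    ((star (Θ t) * U t : unitary (L2 S.totalMeasure →L[ℂ] L2 S.totalMeasure)) :
      L2 S.totalMeasure →L[ℂ] L2 S.totalMeasure) ∘L tensorRight S.oneVec =
      (spread S.twoSidedLaw (measurable_backIncr t)).toContinuousLinearMap := by
  ext1 ψ
  have hmp : MeasurePreserving (Prod.map id (pathShift (-(t : ℝ)))) S.totalMeasure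
      S.totalMeasure :=
    (MeasurePreserving.id _).prod (S.measurePreserving_pathShift _)
  have hone : ∀ᵐ z ∂S.totalMeasure, S.oneVec z.2 = 1 :=
    Measure.quasiMeasurePreserving_snd.ae (Lp.coeFn_const 2 S.twoSidedLaw (1 : ℂ))
  rw [hΘ.star_eq]
  refine Lp.ext ?_
  filter_upwards [hΘc (-t) ((U t).1 (tensor ψ S.oneVec)),
    hmp.quasiMeasurePreserving.ae (hUc t (tensor ψ S.oneVec)),
    hmp.quasiMeasurePreserving.ae ((S.measurePreserving_shift (-t)).quasiMeasurePreserving.ae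
      (tensor_coeFn ψ S.oneVec)),
    hmp.quasiMeasurePreserving.ae ((S.measurePreserving_shift (-t)).quasiMeasurePreserving.ae
      hone),
    spread_coeFn S.twoSidedLaw (measurable_backIncr t) ψ] with z h1 h2 h3 h4 h5
  refine Eq.trans h1 (Eq.trans h2 (Eq.trans h3 (Eq.trans ?_ h5.symm)))
  rw [h4, mul_one]
  rfl

end SubclassicalExtension

end
-- / Assembly /
open SubclassicalExtension in
theorem mainTheorem2 (d : ℕ) {Ω : Type*} [MeasurableSpace Ω]
    (P : ℝ≥0 → (LInf (volume : Measure (E d)) →L[ℂ] LInf (volume : Measure (E d))))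
    (S : IncrementProcess d Ω)
    (hA1 : PreservesLebesgue P)
    (hA2 : S.IsTransitionSemigroup P) :
    -- the two-sided shifts form groups of measure-preserving maps, and `θ` dilates `P`
    (∀ w : PathSpace d, pathShift 0 w = w) ∧
    (∀ s t, ∀ w : PathSpace d, pathShift (s + t) w = pathShift s (pathShift t w)) ∧
    (∀ z : E d × PathSpace d, shift 0 z = z) ∧
    (∀ s t, ∀ z : E d × PathSpace d, shift (s + t) z = shift s (shift t z)) ∧
    (∀ t, MeasurePreserving (pathShift t) S.twoSidedLaw S.twoSidedLaw) ∧
    (∀ t, MeasurePreserving (shift t) S.totalMeasure S.totalMeasure) ∧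
    (∀ (t : ℝ≥0) (f : LInf (volume : Measure (E d))),
      P t f =ᵐ[volume] fun x => ∫ w, f (shift (t : ℝ) (x, w)).1 ∂S.twoSidedLaw) ∧
    -- `U` and `Θ` are the unitary groups of the shifts, `amp X` is `X ⊗ I`
    ∃ (U Θ : ℝ → unitary (L2 S.totalMeasure →L[ℂ] L2 S.totalMeasure))
      (amp : (L2 (volume : Measure (E d)) →L[ℂ] L2 (volume : Measure (E d))) →
        (L2 S.totalMeasure →L[ℂ] L2 S.totalMeasure))
      (V : ℝ≥0 → unitary (L2 S.totalMeasure →L[ℂ] L2 S.totalMeasure))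
      (Q : ℝ≥0 → ((L2 (volume : Measure (E d)) →L[ℂ] L2 (volume : Measure (E d))) →CP
        (L2 (volume : Measure (E d)) →L[ℂ] L2 (volume : Measure (E d))))),
      IsUnitaryGroup U ∧
      (∀ t, IsComposition (U t : L2 S.totalMeasure →L[ℂ] L2 S.totalMeasure) (shift (-t))) ∧
      IsUnitaryGroup Θ ∧
      (∀ t, IsComposition (Θ t : L2 S.totalMeasure →L[ℂ] L2 S.totalMeasure)
        (Prod.map id (pathShift t))) ∧
      (∀ X ψ φ, amp X (tensor ψ φ) = tensor (X ψ) φ) ∧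
      -- the left cocycle
      (∀ t : ℝ≥0, V t = star (Θ t) * U t) ∧
      (∀ s t : ℝ≥0, V (s + t) = star (Θ s) * V t * Θ s * V s) ∧
      -- the quantum extension
      (∀ t X, Q t X = partialTrace S.oneVec
        (star (V t : L2 S.totalMeasure →L[ℂ] L2 S.totalMeasure) * amp X *
          (V t : L2 S.totalMeasure →L[ℂ] L2 S.totalMeasure))) ∧
      IsCPSemigroup Q ∧
      (∀ t f, Q t (mulOp f) = mulOp (P t f)) ∧
      (S.ContinuityCondition → IsQuantumMarkovSemigroup Q) := by
  obtain ⟨U, hU, hUc⟩ := exists_isUnitaryGroup_isComposition (μ := S.totalMeasure)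
    (fun t => shift (-t)) (fun t => S.measurePreserving_shift (-t))
    (fun z => by rw [neg_zero, shift_zero])
    (fun s t z => by rw [neg_add, shift_add])
  obtain ⟨Θ, hΘ, hΘc⟩ := exists_isUnitaryGroup_isComposition (μ := S.totalMeasure)
    (fun t => Prod.map id (pathShift t))
    (fun t => (MeasurePreserving.id _).prod (S.measurePreserving_pathShift t))
    (fun z => by rw [Prod.map_apply, pathShift_zero, id])
    (fun s t z => Prod.ext rfl (pathShift_add s t z.2))
  -- Any Hilbert basis will do: the ampliation is determined by its values on elementary tensors,
  -- which are total.
  obtain ⟨_, e, -⟩ := exists_hilbertBasis ℂ (L2 S.twoSidedLaw)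
  refine ⟨pathShift_zero, pathShift_add, shift_zero, shift_add, S.measurePreserving_pathShift,
    S.measurePreserving_shift, fun t f => ?_, U, Θ, ampliation (isHilbertSum_tensor e),
    fun t => star (Θ t) * U t, S.quantumExt e, hU, hUc, hΘ, hΘc, ampliation_tensor e,
    fun _ => rfl, fun s t => ?_, fun t X => ?_, S.isCPSemigroup_quantumExt e,
    S.quantumExt_mulOp e hA2, S.isQuantumMarkovSemigroup_quantumExt e⟩
  · filter_upwards [hA2 t f] with x hx
    rw [hx, S.integral_X x t (Lp.stronglyMeasurable f),
      S.integral_shift x t (Lp.stronglyMeasurable f)]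
  · exact hU.cocycle hΘ s t
  · rw [IncrementProcess.quantumExt, conjAmp_apply, ← S.star_comp_tensor_oneVec hΘ hUc hΘc t,
      ContinuousLinearMap.adjoint_comp]
    rfl
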